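/- Let $\mathbb H^1=\mathbb R^3$ be the first Heisenberg group with group law $(x,y,t)\circ(x',y',t')=(x+x',y+y',t+t'+\frac12(xy'-x'y))$, let $X_1=\partial_x-\frac y2\partial_t$, $X_2=\partial_y+\frac x2\partial_t$, $T=\partial_t$, and give $\mathbb H^1$ the Riemannian metric for which $X_1,X_2,T$ are orthonormal. For a $C^2$ surface with normal $N$, area element $d\sigma$ and $W=\sqrt{\langle N,X_1\rangle^2+\langle N,X_2\rangle^2}$, the horizontal perimeter is $\mathscr P_H(S)=\int_S \frac{W}{|N|}\,d\sigma$. For $\mathcal X=aX_1+bX_2+kT$ with $a,b,k\in C^2_0(S)$ ($C^2$ with compact support in $S$), the second variation is $\mathcal V^H_{II}(S,\mathcal X)=\frac{d^2}{d\lambda^2}\mathscr P_H(S+\lambda\mathcal X)\big|_{\lambda=0}$, where the perimeter is measured on the part of the surface over the support of $\mathcal X$; $S$ is stable if $\mathcal V^H_{II}(S,\mathcal X)\ge 0$ for all such $\mathcal X$, and unstable otherwise. Let $\epsilon>0$, $J=(-4\epsilon,4\epsilon)$, and let $F,G,\sigma\in C^2(J)$ satisfy $F'(s)^2<2\sigma'(s)G'(s)$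 for all $s\in J$. Assume that $\Psi(u,s)=(u,\,G(s)\frac{u^2}{2}+F(s)u+\sigma(s))$ is one-to-one on $\mathbb R\times J$ (hence a diffeomorphism onto $\Omega=\Psi(\mathbb R\times J)$), write $\Psi^{-1}(u,v)=(u,s(u,v))$, and put $\phi(u,v)=F(s(u,v))+u\,G(s(u,v))$ on $\Omega$. Let $S=\{(0,u,v)\circ(\phi(u,v),0,0): (u,v)\in\Omega\}$ be the corresponding strict intrinsic graphical strip. (i) There is $\psi\in C^2_0(S)$ such that $\lambda\mapsto\mathscr P_H(S+\lambda\psi X_1)$ is $C^2$ near $\lambda=0$ and $\mathcal V^H_{II}(S,\psi X_1)<0$. (ii) Consequently $S$ is unstable. (iii) Suppose moreover that $G'>0$ on $J$. Let $0<\delta<2\epsilon$, let $\chi\in C^\infty(\mathbb R)$ with $0\le\chi\le1$, $\chi=1$ on $\{|s|\le\delta\}$ and $\chi=0$ on $\{|s|\ge2\delta\}$, and let $\zeta\in C^\infty(\mathbb R)$ with $\zeta\ge0$, $\operatorname{supp}\zeta=[-1,1]$, $\int\zeta=1$. Put $\chi_k(u)=\chi(u/k)$, $\zeta_k(s)=k\zeta(ks)$,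 $F_k=F\star\zeta_k$, $G_k=G\star\zeta_k$, $\sigma_k=\sigma\star\zeta_k$ and $Q_k(u,s)=G_k'(s)\frac{u^2}{2}+F_k'(s)u+\sigma_k'(s)$, and let $\psi_k$ be the function on $S$ given in the parameters $(u,s)$ by $\chi(s)\chi_k(u)/Q_k(u,s)^{1/2}$. Then for all large $k$ one has $\psi_k\in C^2_0(S)$ and $\lambda\mapsto\mathscr P_H(S+\lambda\psi_kX_1)$ is $C^2$ near $0$, and $$\lim_{k\to\infty}\mathcal V^H_{II}(S,\psi_kX_1)=\Big(\frac\pi2-2\pi\Big)\int_J\frac{\chi(s)^2}{(1+G(s)^2)^{3/2}}\,\frac{G'(s)}{(2\sigma'(s)G'(s)-F'(s)^2)^{1/2}}\,ds,$$ where the integral on the right is positive. -/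

import Mathlib

open Set Filter Topology MeasureTheory

noncomputable section

namespace Heisenberg

/-! ### The first Heisenberg group -/

/-- Points `(x, y, t)` of the first Heisenberg group, and tangent vectors in the coordinate basis
`∂x, ∂y, ∂t`. -/
abbrev H1 : Type := ℝ × ℝ × ℝ

/-- The group law of the first Heisenberg group. -/
def op (g g' : H1) : H1 :=
  (g.1 + g'.1, g.2.1 + g'.2.1, g.2.2 + g'.2.2 + (1 / 2) * (g.1 * g'.2.1 - g'.1 * g.2.1))

/-- `X₁ = ∂x - (y/2) ∂t`. -/
def X1 (g : H1) : H1 := (1, 0, -(g.2.1 / 2))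

/-- `X₂ = ∂y + (x/2) ∂t`. -/
def X2 (g : H1) : H1 := (0, 1, g.1 / 2)

/-- `T = ∂t`. -/
def T (_g : H1) : H1 := (0, 0, 1)

/-- The components of the tangent vector `w` at `g` in the frame `X₁, X₂, T`. The Riemannian metric
is the one that makes this frame orthonormal, so that inner products, norms and (with this
orientation) cross products of tangent vectors are computed on these components. -/
def frame (g w : H1) : Fin 3 → ℝ := ![w.1, w.2.1, w.2.2 + g.2.1 / 2 * w.1 - g.1 / 2 * w.2.1]

theorem frame_spec (g w : H1) :
    frame g w 0 • X1 g + frame g w 1 • X2 g + frame g w 2 • T g = w := by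
  ext <;> simp [frame, X1, X2, T]
  ring

/-! ### Parametrized surfaces and horizontal perimeter

A surface is given here by a parametrization `θ` of it by points of the `(u, v)`-plane. -/

/-- The (non-unit) Riemannian normal `N = θ_u × θ_v`, in the frame `X₁, X₂, T`. -/
def normal (θ : ℝ × ℝ → H1) (z : ℝ × ℝ) : Fin 3 → ℝ :=
  crossProduct (frame (θ z) (fderiv ℝ θ z (1, 0))) (frame (θ z) (fderiv ℝ θ z (0, 1)))

/-- `|N|`; the Riemannian surface area element is `dσ = |N| du dv`. -/
def normalLength (θ : ℝ × ℝ → H1) (z : ℝ × ℝ) : ℝ :=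
  √(normal θ z 0 ^ 2 + normal θ z 1 ^ 2 + normal θ z 2 ^ 2)

/-- `W = √(p² + q²)`, with `p = ⟨N, X₁⟩` and `q = ⟨N, X₂⟩`. -/
def W (θ : ℝ × ℝ → H1) (z : ℝ × ℝ) : ℝ :=
  √(normal θ z 0 ^ 2 + normal θ z 1 ^ 2)

/-- The horizontal perimeter `∫ (W / |N|) dσ` of the piece of the surface parametrized by `D`. -/
def horizontalPerimeter (θ : ℝ × ℝ → H1) (D : Set (ℝ × ℝ)) : ℝ :=
  ∫ z in D, W θ z / normalLength θ z * normalLength θ z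

/-! ### Intrinsic graphs -/

/-- The parametrization `(u, v) ↦ (0, u, v) ∘ (φ(u, v), 0, 0)` of an intrinsic `X₁`-graph. -/
def graphMap (φ : ℝ × ℝ → ℝ) (z : ℝ × ℝ) : H1 := op (0, z.1, z.2) (φ z, 0, 0)

theorem graphMap_eq (φ : ℝ × ℝ → ℝ) (u v : ℝ) :
    graphMap φ (u, v) = (φ (u, v), u, v - u / 2 * φ (u, v)) := by
  ext <;> simp [graphMap, op]
  ring

/-- The coordinates `(u, v)` of the point `(0, u, v) ∘ (x, 0, 0) = (x, u, v - u x / 2)`. -/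
def coord (g : H1) : ℝ × ℝ := (g.2.1, g.2.2 + g.1 * g.2.1 / 2)

theorem coord_graphMap (φ : ℝ × ℝ → ℝ) (z : ℝ × ℝ) : coord (graphMap φ z) = z := by
  ext <;> simp [coord, graphMap, op]
  ring

/-- The domain `Ω` in the `(u, v)`-plane over which `S` is an intrinsic `X₁`-graph. -/
def graphDomain (S : Set H1) : Set (ℝ × ℝ) := coord '' S

/-- The parametrization of an intrinsic `X₁`-graph `S` over its domain, recovered from `S`. -/
def param (S : Set H1) : ℝ × ℝ → H1 := Function.invFunOn coord S

theorem graphDomain_graph (φ : ℝ × ℝ → ℝ) (Ω : Set (ℝ × ℝ)) :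
    graphDomain (graphMap φ '' Ω) = Ω := by
  simp [graphDomain, image_image, coord_graphMap]

theorem param_graph (φ : ℝ × ℝ → ℝ) (Ω : Set (ℝ × ℝ)) {z : ℝ × ℝ} (hz : z ∈ Ω) :
    param (graphMap φ '' Ω) z = graphMap φ z := by
  have h : ∃ g ∈ graphMap φ '' Ω, coord g = z :=
    ⟨graphMap φ z, mem_image_of_mem _ hz, coord_graphMap φ z⟩
  obtain ⟨w, -, hw⟩ := Function.invFunOn_mem h
  have h2 := Function.invFunOn_eq h
  rw [← hw, coord_graphMap] at h2
  rw [param, ← hw, h2]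

/-! ### Variations and stability of an intrinsic `X₁`-graph `S` -/

/-- `ψ ∈ C²₀(S)`: `ψ` is of class `C²` on `S` and vanishes on `S` outside a compact subset of `S`.
Only the values of `ψ` on `S` matter. -/
def C20 (S : Set H1) (ψ : H1 → ℝ) : Prop :=
  ContDiffOn ℝ 2 (fun z => ψ (param S z)) (graphDomain S) ∧
    ∃ K ⊆ S, IsCompact K ∧ ∀ g ∈ S \ K, ψ g = 0

/-- The vector field `a X₁ + b X₂ + k T`. -/
def field (a b k : H1 → ℝ) (g : H1) : H1 := a g • X1 g + b g • X2 g + k g • T g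

/-- The vector field `ψ X₁`. -/
def fieldX1 (ψ : H1 → ℝ) : H1 → H1 := field ψ (fun _ => 0) (fun _ => 0)

/-- The support of the restriction of `V` to `S`, in the `(u, v)`-plane. -/
def supportOn (S : Set H1) (V : H1 → H1) : Set (ℝ × ℝ) :=
  closure {z ∈ graphDomain S | V (param S z) ≠ 0}

/-- The horizontal perimeter of the deformed surface `S + lam V`, as a function of `lam`. As usual
for a compactly supported `V` on a surface of possibly infinite perimeter, only the part of the
surface over the support of `V` is measured; the rest does not move. -/
def perimeterVariation (S : Set H1) (V : H1 → H1) (lam : ℝ) : ℝ :=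
  horizontalPerimeter (fun z => param S z + lam • V (param S z)) (supportOn S V)

/-- The second variation of the horizontal perimeter of `S` in the direction `V`. -/
def secondVariation (S : Set H1) (V : H1 → H1) : ℝ :=
  iteratedDeriv 2 (perimeterVariation S V) 0

/-- `S` is stable: its second variation is nonnegative in every direction `a X₁ + b X₂ + k T` with
`a, b, k ∈ C²₀(S)`. -/
def IsStable (S : Set H1) : Prop :=
  ∀ a b k : H1 → ℝ, C20 S a → C20 S b → C20 S k → 0 ≤ secondVariation S (field a b k)

/-! ### Strict intrinsic graphical strips -/

/-- The interval `J = (-4ε, 4ε)`. -/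
def stripJ (ε : ℝ) : Set ℝ := Ioo (-(4 * ε)) (4 * ε)

/-- The map `Ψ(u, s) = (u, G(s) u²/2 + F(s) u + σ(s))`. -/
def Psi (F G σ : ℝ → ℝ) (w : ℝ × ℝ) : ℝ × ℝ :=
  (w.1, G w.2 * (w.1 ^ 2 / 2) + F w.2 * w.1 + σ w.2)

/-- `Ω = Ψ(ℝ × J)`. -/
def stripDomain (ε : ℝ) (F G σ : ℝ → ℝ) : Set (ℝ × ℝ) := Psi F G σ '' (univ ×ˢ stripJ ε)

/-- The inverse of `Ψ : ℝ × J → Ω`; its second component is `s(u, v)`. -/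
def PsiInv (ε : ℝ) (F G σ : ℝ → ℝ) : ℝ × ℝ → ℝ × ℝ :=
  Function.invFunOn (Psi F G σ) (univ ×ˢ stripJ ε)

/-- `φ(u, v) = F(s(u, v)) + u G(s(u, v))`. -/
def stripPhi (ε : ℝ) (F G σ : ℝ → ℝ) (z : ℝ × ℝ) : ℝ :=
  F (PsiInv ε F G σ z).2 + z.1 * G (PsiInv ε F G σ z).2

/-- `S` is the strict intrinsic graphical strip on `J = (-4ε, 4ε)` given by `F, G, σ`. -/
structure IsStrictStrip (ε : ℝ) (F G σ : ℝ → ℝ) (S : Set H1) : Prop where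
  eps_pos : 0 < ε
  contDiffOn_F : ContDiffOn ℝ 2 F (stripJ ε)
  contDiffOn_G : ContDiffOn ℝ 2 G (stripJ ε)
  contDiffOn_σ : ContDiffOn ℝ 2 σ (stripJ ε)
  strict : ∀ s ∈ stripJ ε, deriv F s ^ 2 < 2 * deriv σ s * deriv G s
  injOn : InjOn (Psi F G σ) (univ ×ˢ stripJ ε)
  eq_graph : S = graphMap (stripPhi ε F G σ) '' stripDomain ε F G σ

/-! ### The explicit test functions -/

/-- `χ` is a smooth cutoff function: `0 ≤ χ ≤ 1`, `χ = 1` on `[-δ, δ]`, `χ = 0` off `(-2δ, 2δ)`. -/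
structure IsCutoff (δ : ℝ) (χ : ℝ → ℝ) : Prop where
  smooth : ContDiff ℝ (⊤ : ℕ∞) χ
  nonneg : ∀ s, 0 ≤ χ s
  le_one : ∀ s, χ s ≤ 1
  eq_one : ∀ s, |s| ≤ δ → χ s = 1
  eq_zero : ∀ s, 2 * δ ≤ |s| → χ s = 0

/-- `ζ` is a smooth mollifier: `ζ ≥ 0`, `supp ζ = [-1, 1]`, `∫ ζ = 1`. -/
structure IsMollifier (ζ : ℝ → ℝ) : Prop where
  smooth : ContDiff ℝ (⊤ : ℕ∞) ζ
  nonneg : ∀ s, 0 ≤ ζ s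
  tsupport_eq : tsupport ζ = Icc (-1) 1
  integral_eq : ∫ s, ζ s = 1

/-- The regularization `f ⋆ ζ_k`, where `ζ_k(s) = k ζ(k s)`. -/
def mollify (ζ : ℝ → ℝ) (k : ℕ) (f : ℝ → ℝ) (s : ℝ) : ℝ :=
  ∫ r, f r * (k * ζ (k * (s - r)))

/-- `Q_k(u, s) = G_k'(s) u²/2 + F_k'(s) u + σ_k'(s)`, with `F_k = F ⋆ ζ_k` and so on. -/
def Qk (ζ F G σ : ℝ → ℝ) (k : ℕ) (u s : ℝ) : ℝ :=
  deriv (mollify ζ k G) s * (u ^ 2 / 2) + deriv (mollify ζ k F) s * u + deriv (mollify ζ k σ) s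

/-- `χ(s) χ_k(u) / Q_k(u, s)^{1/2}` as a function of `(u, s)`, where `χ_k(u) = χ(u / k)`. -/
def testPlane (χ ζ F G σ : ℝ → ℝ) (k : ℕ) (w : ℝ × ℝ) : ℝ :=
  χ w.2 * χ (w.1 / k) / √(Qk ζ F G σ k w.1 w.2)

/-- The function on the strip `S` that corresponds to `testPlane` under the parametrization of `S`
by `(u, s)`. -/
def testSurface (ε : ℝ) (χ ζ F G σ : ℝ → ℝ) (k : ℕ) (g : H1) : ℝ :=
  testPlane χ ζ F G σ k (PsiInv ε F G σ (coord g))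

/-- The integral
`∫_J χ(s)² (1 + G(s)²)^{-3/2} G'(s) (2 σ'(s) G'(s) - F'(s)²)^{-1/2} ds`. -/
def limitIntegral (ε : ℝ) (χ F G σ : ℝ → ℝ) : ℝ :=
  ∫ s in stripJ ε, χ s ^ 2 / (1 + G s ^ 2) ^ (3 / 2 : ℝ) *
    (deriv G s / √(2 * deriv σ s * deriv G s - deriv F s ^ 2))

end Heisenberg

end

open Heisenberg

/-! ### Integrals depending on a parameter over a compact set -/

/-! For an intrinsic graph the perimeter density is `√(1 + (φ_u + φ φ_v)²)`. The lines `s = const`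
of `Ψ` are the characteristics of `φ`: along them `∂v/∂u = F + u G = φ`, so `φ_u + φ φ_v = ∂_u (F +
u G) = G`. With `Q = ∂v/∂s = G' u²/2 + F' u + σ'` one also has `φ_v = Q_u / Q`. If `ψ` is `H(u, s)`
in these parameters, the second variation becomes the integral of `(H_u + H Q_u/Q)² Q / (1 +
G²)^{3/2} + 2 G H H_s / √(1 + G²)`, and integrating the last term by parts in `s` turns it into `-G'
H² / (1 + G²)^{3/2}` (`secondVariation_eq`).

The favourable choice is `H = χ(s) Q^{-1/2}`: the density reduces to `χ² (1 + G²)^{-3/2} ((Q_u /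
2Q)² - G'/Q)`. Since `∫ du/Q = 2π / √(2σ'G' - F'²)`, and an integration by parts gives `∫ (Q_u /
2Q)² du = (G'/4) ∫ du/Q`, the `u`-integral is `(π/2 - 2π) G' / √(2σ'G' - F'²)`, which is negative
when `G' > 0` (`integral_density_self`).

This `H` has no compact support in `u` and is only `C¹`, because `Q` contains first derivatives of
`C²` functions. Hence the cutoff `χ(u/k)` and the mollified `Q_k`. No `s`-derivative of `H` survives
in the integrated formula, so uniform convergence of the coefficients of `Q_k` is enough. Strictness
makes `Q` comparable to `1 + u²` uniformly for `s` in a compact set, which bounds all densities by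
`C / (1 + u²)`, and dominated convergence applies (`tendsto_integral_density`).

For instability without a sign assumption, strictness forbids a zero of `G'`, so `G'` has constant
sign, and `s ↦ -s` reduces a negative sign to a positive one. -/

theorem exists_bound_near {X : Type*} [TopologicalSpace X] {D : Set X} (hD : IsCompact D)
    {f : ℝ → X → ℝ} (hf : ContinuousOn (Function.uncurry f) (univ ×ˢ D)) (x₀ : ℝ) :
    ∃ C, ∀ x ∈ Metric.ball x₀ 1, ∀ z ∈ D, ‖f x z‖ ≤ C := by
  obtain ⟨C, hC⟩ := ((isCompact_closedBall x₀ 1).prod hD).exists_bound_of_continuousOn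
    (hf.mono (prod_mono (subset_univ _) subset_rfl))
  exact ⟨C, fun x hx z hz => hC (x, z) ⟨Metric.ball_subset_closedBall hx, hz⟩⟩

theorem ContinuousOn.of_uncurry_left {X : Type*} [TopologicalSpace X] {D : Set X}
    {f : ℝ → X → ℝ} (hf : ContinuousOn (Function.uncurry f) (univ ×ˢ D)) (x : ℝ) :
    ContinuousOn (f x) D :=
  hf.comp (f := fun z => (x, z)) (by fun_prop) (fun z hz => ⟨mem_univ _, hz⟩)

theorem continuous_setIntegral_of_isCompact {f : ℝ → ℝ × ℝ → ℝ} {D : Set (ℝ × ℝ)}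
    (hD : IsCompact D) (hf : ContinuousOn (Function.uncurry f) (univ ×ˢ D)) :
    Continuous fun x => ∫ z in D, f x z := by
  refine continuous_iff_continuousAt.2 fun x₀ => ?_
  obtain ⟨C, hC⟩ := exists_bound_near hD hf x₀
  have hm := hD.isClosed.measurableSet
  refine continuousAt_of_dominated (bound := fun _ => C) ?_ ?_ ?_ ?_
  · exact Eventually.of_forall fun x => (hf.of_uncurry_left x).aestronglyMeasurable hm
  · filter_upwards [Metric.ball_mem_nhds x₀ one_pos] with x hx
    exact (ae_restrict_iff' hm).2 (Eventually.of_forall fun z hz => hC x hx z hz)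
  · exact integrableOn_const hD.measure_lt_top.ne
  · refine (ae_restrict_iff' hm).2 (Eventually.of_forall fun z hz => ?_)
    exact (hf.comp_continuous (f := fun x => (x, z)) (by fun_prop)
      (fun x => ⟨mem_univ _, hz⟩)).continuousAt

theorem hasDerivAt_setIntegral_of_isCompact {f f' : ℝ → ℝ × ℝ → ℝ} {D : Set (ℝ × ℝ)}
    (hD : IsCompact D) (hf : ContinuousOn (Function.uncurry f) (univ ×ˢ D))
    (hf' : ContinuousOn (Function.uncurry f') (univ ×ˢ D))
    (h : ∀ x, ∀ z ∈ D, HasDerivAt (fun y => f y z) (f' x z) x) (x₀ : ℝ) :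
    HasDerivAt (fun x => ∫ z in D, f x z) (∫ z in D, f' x₀ z) x₀ := by
  obtain ⟨C, hC⟩ := exists_bound_near hD hf' x₀
  have hm := hD.isClosed.measurableSet
  refine (hasDerivAt_integral_of_dominated_loc_of_deriv_le (bound := fun _ => C)
    (Metric.ball_mem_nhds x₀ one_pos) ?_ ?_ ?_ ?_ ?_ ?_).2
  · exact Eventually.of_forall fun x => (hf.of_uncurry_left x).aestronglyMeasurable hm
  · exact (hf.of_uncurry_left x₀).integrableOn_compact hD
  · exact (hf'.of_uncurry_left x₀).aestronglyMeasurable hm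
  · exact (ae_restrict_iff' hm).2 (Eventually.of_forall fun z hz x hx => hC x hx z hz)
  · exact integrableOn_const hD.measure_lt_top.ne
  · exact (ae_restrict_iff' hm).2 (Eventually.of_forall fun z hz x _ => h x z hz)

theorem contDiff_two_of_hasDerivAt {f f' f'' : ℝ → ℝ} (h1 : ∀ x, HasDerivAt f (f' x) x)
    (h2 : ∀ x, HasDerivAt f' (f'' x) x) (h3 : Continuous f'') :
    ContDiff ℝ 2 f ∧ ∀ x, iteratedDeriv 2 f x = f'' x := by
  have e1 : deriv f = f' := funext fun x => (h1 x).deriv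
  have e2 : deriv f' = f'' := funext fun x => (h2 x).deriv
  constructor
  · have : (2 : WithTop ℕ∞) = 1 + 1 := by norm_num
    rw [this, contDiff_succ_iff_deriv]
    refine ⟨fun x => (h1 x).differentiableAt, by simp, ?_⟩
    rw [e1, contDiff_one_iff_deriv, e2]
    exact ⟨fun x => (h2 x).differentiableAt, h3⟩
  · intro x
    rw [iteratedDeriv_succ, iteratedDeriv_one, e1, e2]

/-- For `f = √(1 + p²)` with `p = A + x L + x² M`, the identity `f² = 1 + p²` collapses the second
derivative to `p'² / f³ + p p'' / f`, where `p'' = 2 M`. Compactness of `D` permits differentiation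
under the integral for every `x`. -/
theorem contDiff_integral_sqrt {D : Set (ℝ × ℝ)} (hD : IsCompact D) {A L M : ℝ × ℝ → ℝ}
    (hA : ContinuousOn A D) (hL : ContinuousOn L D) (hM : ContinuousOn M D) :
    ContDiff ℝ 2 (fun x : ℝ => ∫ z in D, √(1 + (A z + x * L z + x ^ 2 * M z) ^ 2)) ∧
    iteratedDeriv 2 (fun x : ℝ => ∫ z in D, √(1 + (A z + x * L z + x ^ 2 * M z) ^ 2)) 0 =
      ∫ z in D, (L z ^ 2 / √(1 + A z ^ 2) ^ 3 + 2 * A z * M z / √(1 + A z ^ 2)) := by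
  set p : ℝ → ℝ × ℝ → ℝ := fun x z => A z + x * L z + x ^ 2 * M z with hp
  set p' : ℝ → ℝ × ℝ → ℝ := fun x z => L z + 2 * x * M z with hp'
  set f : ℝ → ℝ × ℝ → ℝ := fun x z => √(1 + p x z ^ 2) with hf
  set f' : ℝ → ℝ × ℝ → ℝ := fun x z => p x z * p' x z / f x z with hf'
  set f'' : ℝ → ℝ × ℝ → ℝ := fun x z => p' x z ^ 2 / f x z ^ 3 + 2 * p x z * M z / f x z with hf''
  have hpos : ∀ x z, 0 < f x z := fun x z => Real.sqrt_pos.2 (by positivity)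
  have hsq : ∀ x z, f x z ^ 2 = 1 + p x z ^ 2 := fun x z => Real.sq_sqrt (by positivity)
  have lift : ∀ {g : ℝ × ℝ → ℝ}, ContinuousOn g D →
      ContinuousOn (fun y : ℝ × (ℝ × ℝ) => g y.2) (univ ×ˢ D) := fun hg =>
    hg.comp continuousOn_snd fun y hy => hy.2
  have hA' := lift hA
  have hL' := lift hL
  have hM' := lift hM
  have cp : ContinuousOn (Function.uncurry p) (univ ×ˢ D) := by
    simp only [hp, Function.uncurry_def]; fun_prop
  have cp' : ContinuousOn (Function.uncurry p') (univ ×ˢ D) := by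
    simp only [hp', Function.uncurry_def]; fun_prop
  have cf : ContinuousOn (Function.uncurry f) (univ ×ˢ D) :=
    (continuousOn_const.add (cp.pow 2)).sqrt
  have cf' : ContinuousOn (Function.uncurry f') (univ ×ˢ D) :=
    (cp.mul cp').div cf fun y _ => (hpos y.1 y.2).ne'
  have cf'' : ContinuousOn (Function.uncurry f'') (univ ×ˢ D) :=
    ((cp'.pow 2).div (cf.pow 3) fun y _ => (pow_pos (hpos y.1 y.2) 3).ne').add
      (((continuousOn_const.mul cp).mul hM').div cf fun y _ => (hpos y.1 y.2).ne')
  have dp : ∀ x z, HasDerivAt (fun y => p y z) (p' x z) x := by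
    intro x z
    have h := (((hasDerivAt_id x).mul_const (L z)).const_add (A z)).add
      (((hasDerivAt_id x).pow 2).mul_const (M z))
    convert! h using 1
    simp [hp']
  have dp' : ∀ x z, HasDerivAt (fun y => p' y z) (2 * M z) x := by
    intro x z
    have h := ((((hasDerivAt_id x).const_mul 2).mul_const (M z)).const_add (L z))
    convert! h using 1
    simp
  have df : ∀ x z, HasDerivAt (fun y => f y z) (f' x z) x := by
    intro x z
    have h := (((dp x z).pow 2).const_add 1).sqrt (by positivity : (1 + p x z ^ 2) ≠ 0)
    convert! h using 1
    have := (hpos x z).ne'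
    simp only [hf', hf, Pi.pow_apply] at this ⊢
    field_simp
    push_cast
    ring
  have df' : ∀ x z, HasDerivAt (fun y => f' y z) (f'' x z) x := by
    intro x z
    have h := ((dp x z).mul (dp' x z)).div (df x z) (hpos x z).ne'
    convert! h using 1
    have h0 := (hpos x z).ne'
    have h1 := hsq x z
    simp only [hf'', hf', Pi.mul_apply]
    field_simp
    rw [h1]; ring
  have D1 := hasDerivAt_setIntegral_of_isCompact hD cf cf' (fun x z _ => df x z)
  have D2 := hasDerivAt_setIntegral_of_isCompact hD cf' cf'' (fun x z _ => df' x z)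
  have D3 := continuous_setIntegral_of_isCompact hD cf''
  have key := contDiff_two_of_hasDerivAt D1 D2 D3
  refine ⟨key.1, (key.2 0).trans ?_⟩
  simp [hf'', hf, hp, hp']

/-! ### Horizontal perimeter of intrinsic graphs and of their variations -/

theorem fderiv_graphMap_apply {φ : ℝ × ℝ → ℝ} {z : ℝ × ℝ} (h : DifferentiableAt ℝ φ z)
    (w : ℝ × ℝ) : fderiv ℝ (graphMap φ) z w =
      (fderiv ℝ φ z w, w.1, w.2 - (w.1 / 2 * φ z + z.1 / 2 * fderiv ℝ φ z w)) := by
  have e : graphMap φ = fun z => (φ z, z.1, z.2 - z.1 / 2 * φ z) :=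
    funext fun z => graphMap_eq φ z.1 z.2
  have h1 : HasFDerivAt φ (fderiv ℝ φ z) z := h.hasFDerivAt
  have h2 : HasFDerivAt (fun z : ℝ × ℝ => z.1 / 2)
      ((2 : ℝ)⁻¹ • ContinuousLinearMap.fst ℝ ℝ ℝ) z := by
    have := (hasFDerivAt_fst (𝕜 := ℝ) (p := z)).const_smul (2 : ℝ)⁻¹
    convert! this using 1
    ext y; simp; ring
  have h3 := h1.prodMk ((hasFDerivAt_fst (𝕜 := ℝ) (p := z)).prodMk
    ((hasFDerivAt_snd (𝕜 := ℝ) (p := z)).sub (h2.mul h1)))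
  rw [e]
  erw [h3.fderiv]
  ext <;> simp
  ring

theorem perimeter_integrand_graphMap {φ : ℝ × ℝ → ℝ} {z : ℝ × ℝ} (h : DifferentiableAt ℝ φ z) :
    W (graphMap φ) z / normalLength (graphMap φ) z * normalLength (graphMap φ) z =
      √(1 + (fderiv ℝ φ z (1, 0) + φ z * fderiv ℝ φ z (0, 1)) ^ 2) := by
  obtain ⟨u, v⟩ := z
  -- The first component of the normal is constantly 1, so the surface has no characteristic points
  -- and `W` never vanishes.
  have hN : normal (graphMap φ) (u, v) = ![1, -(fderiv ℝ φ (u, v) (1, 0) +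
      φ (u, v) * fderiv ℝ φ (u, v) (0, 1)), -fderiv ℝ φ (u, v) (0, 1)] := by
    simp only [normal, fderiv_graphMap_apply h, graphMap_eq, frame, cross_apply]
    ext i
    fin_cases i <;> simp
    ring
  have hpos : 0 < normalLength (graphMap φ) (u, v) := by
    rw [normalLength, hN]
    refine Real.sqrt_pos.2 ?_
    simp
    positivity
  rw [div_mul_cancel₀ _ hpos.ne', W, hN]
  simp only [Matrix.cons_val_zero, Matrix.cons_val_one, neg_sq, one_pow]

theorem fieldX1_apply (ψ : H1 → ℝ) (g : H1) : fieldX1 ψ g = (ψ g, 0, -(ψ g * (g.2.1 / 2))) := by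
  ext <;> simp [fieldX1, field, X1, X2, T]

theorem fieldX1_eq_zero_iff (ψ : H1 → ℝ) (g : H1) : fieldX1 ψ g = 0 ↔ ψ g = 0 := by
  rw [fieldX1_apply]
  constructor
  · intro h
    simpa using congrArg Prod.fst h
  · intro h
    simp [h]

/-- Integral curves of `X₁` are straight lines along which `coord` is constant, so the deformed
surface is again an intrinsic graph over the same domain. This reduces the variation to replacing
`φ` by `φ + x h`. -/
theorem graphMap_add_smul_fieldX1 (φ : ℝ × ℝ → ℝ) (ψ : H1 → ℝ) (x : ℝ) (z : ℝ × ℝ) :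
    graphMap φ z + x • fieldX1 ψ (graphMap φ z) =
      graphMap (fun z => φ z + x * ψ (graphMap φ z)) z := by
  obtain ⟨u, v⟩ := z
  rw [fieldX1_apply]
  generalize hr : ψ (graphMap φ (u, v)) = r
  rw [graphMap_eq, graphMap_eq]
  ext <;> simp [hr]
  ring

theorem supportOn_fieldX1_graph (φ : ℝ × ℝ → ℝ) (ψ : H1 → ℝ) (Ω : Set (ℝ × ℝ)) :
    supportOn (graphMap φ '' Ω) (fieldX1 ψ) = closure {z ∈ Ω | ψ (graphMap φ z) ≠ 0} := by
  rw [supportOn, graphDomain_graph]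
  congr 1
  ext z
  simp only [mem_ofPred_eq]
  refine and_congr_right fun hz => ?_
  rw [param_graph φ Ω hz, Ne, fieldX1_eq_zero_iff]

section Variation

variable {φ : ℝ × ℝ → ℝ} {ψ : H1 → ℝ} {Ω : Set (ℝ × ℝ)}

theorem perimeterVariation_fieldX1_graph (hΩ : IsOpen Ω) (hφ : DifferentiableOn ℝ φ Ω)
    {h : ℝ × ℝ → ℝ} (hψ : ∀ z ∈ Ω, ψ (graphMap φ z) = h z) (hh : DifferentiableOn ℝ h Ω)
    (hsub : closure {z ∈ Ω | h z ≠ 0} ⊆ Ω) (x : ℝ) :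
    perimeterVariation (graphMap φ '' Ω) (fieldX1 ψ) x =
      ∫ z in closure {z ∈ Ω | h z ≠ 0},
        √(1 + (fderiv ℝ φ z (1, 0) + φ z * fderiv ℝ φ z (0, 1) +
          x * (fderiv ℝ h z (1, 0) + φ z * fderiv ℝ h z (0, 1) + h z * fderiv ℝ φ z (0, 1)) +
          x ^ 2 * (h z * fderiv ℝ h z (0, 1))) ^ 2) := by
  have hset : {z ∈ Ω | ψ (graphMap φ z) ≠ 0} = {z ∈ Ω | h z ≠ 0} := by
    ext z
    exact and_congr_right fun hz => by rw [hψ z hz]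
  rw [perimeterVariation, supportOn_fieldX1_graph, horizontalPerimeter, hset]
  refine setIntegral_congr_fun isClosed_closure.measurableSet fun z hz => ?_
  have hzΩ := hsub hz
  have hloc : (fun z => param (graphMap φ '' Ω) z + x • fieldX1 ψ (param (graphMap φ '' Ω) z))
      =ᶠ[𝓝 z] graphMap (fun z => φ z + x * h z) := by
    filter_upwards [hΩ.mem_nhds hzΩ] with y hy
    rw [param_graph φ Ω hy, graphMap_add_smul_fieldX1]
    simp only [graphMap] at hψ ⊢
    rw [hψ y hy]
  have dφ := hφ.differentiableAt (hΩ.mem_nhds hzΩ)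
  have dh := hh.differentiableAt (hΩ.mem_nhds hzΩ)
  have hd : DifferentiableAt ℝ (fun z => φ z + x * h z) z := dφ.add (dh.const_mul x)
  have hfd : ∀ w, fderiv ℝ (fun z => φ z + x * h z) z w = fderiv ℝ φ z w + x * fderiv ℝ h z w := by
    intro w
    erw [(dφ.hasFDerivAt.add (dh.hasFDerivAt.const_mul x)).fderiv]
    simp
  have hN : normal (fun z => param (graphMap φ '' Ω) z + x • fieldX1 ψ (param (graphMap φ '' Ω) z)) z
      = normal (graphMap (fun z => φ z + x * h z)) z := by
    rw [normal, normal, hloc.fderiv_eq, hloc.eq_of_nhds]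
  have key := perimeter_integrand_graphMap hd
  simp only [W, normalLength] at key ⊢
  rw [hN]
  refine key.trans ?_
  rw [hfd, hfd]
  congr 3
  ring

/-- The second variation in the direction `ψ X₁` of an intrinsic graph: `ψ` is given by
the function `h` on the domain `Ω`. -/
theorem secondVariation_fieldX1_graph (hΩ : IsOpen Ω) (hφ : ContDiffOn ℝ 1 φ Ω)
    {h : ℝ × ℝ → ℝ} (hψ : ∀ z ∈ Ω, ψ (graphMap φ z) = h z) (hh : ContDiffOn ℝ 1 h Ω)
    {K : Set (ℝ × ℝ)} (hK : IsCompact K) (hKΩ : K ⊆ Ω) (hsupp : ∀ z ∈ Ω, z ∉ K → h z = 0) :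
    ContDiff ℝ 2 (perimeterVariation (graphMap φ '' Ω) (fieldX1 ψ)) ∧
    secondVariation (graphMap φ '' Ω) (fieldX1 ψ) =
      ∫ z in K, ((fderiv ℝ h z (1, 0) + φ z * fderiv ℝ h z (0, 1) + h z * fderiv ℝ φ z (0, 1)) ^ 2 /
          √(1 + (fderiv ℝ φ z (1, 0) + φ z * fderiv ℝ φ z (0, 1)) ^ 2) ^ 3 +
        2 * (fderiv ℝ φ z (1, 0) + φ z * fderiv ℝ φ z (0, 1)) * (h z * fderiv ℝ h z (0, 1)) /
          √(1 + (fderiv ℝ φ z (1, 0) + φ z * fderiv ℝ φ z (0, 1)) ^ 2)) := by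
  set D := closure {z ∈ Ω | h z ≠ 0} with hDdef
  have hDK : D ⊆ K := closure_minimal (fun z hz => by
    by_contra hzK
    exact hz.2 (hsupp z hz.1 hzK)) hK.isClosed
  have hD : IsCompact D := hK.of_isClosed_subset isClosed_closure hDK
  have hDΩ : D ⊆ Ω := hDK.trans hKΩ
  have cφ : ContinuousOn φ Ω := hφ.continuousOn
  have ch : ContinuousOn h Ω := hh.continuousOn
  have cφ' : ∀ w, ContinuousOn (fun z => fderiv ℝ φ z w) Ω := fun w =>
    (hφ.continuousOn_fderiv_of_isOpen hΩ le_rfl).clm_apply continuousOn_const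
  have ch' : ∀ w, ContinuousOn (fun z => fderiv ℝ h z w) Ω := fun w =>
    (hh.continuousOn_fderiv_of_isOpen hΩ le_rfl).clm_apply continuousOn_const
  have hP : perimeterVariation (graphMap φ '' Ω) (fieldX1 ψ) = _ := funext fun x =>
    perimeterVariation_fieldX1_graph hΩ (hφ.differentiableOn one_ne_zero) hψ
      (hh.differentiableOn one_ne_zero) hDΩ x
  have key := contDiff_integral_sqrt hD
    (A := fun z => fderiv ℝ φ z (1, 0) + φ z * fderiv ℝ φ z (0, 1))
    (L := fun z => fderiv ℝ h z (1, 0) + φ z * fderiv ℝ h z (0, 1) + h z * fderiv ℝ φ z (0, 1))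
    (M := fun z => h z * fderiv ℝ h z (0, 1))
    (((cφ' _).add (cφ.mul (cφ' _))).mono hDΩ)
    ((((ch' _).add (cφ.mul (ch' _))).add (ch.mul (cφ' _))).mono hDΩ)
    ((ch.mul (ch' _)).mono hDΩ)
  rw [secondVariation, hP]
  refine ⟨key.1, key.2.trans ?_⟩
  -- The domain may be enlarged from the support `D` to `K`: off `D` the function `h` vanishes on a
  -- neighbourhood, hence so do its derivatives and the integrand.
  refine (setIntegral_eq_of_subset_of_forall_sdiff_eq_zero hK.isClosed.measurableSet hDK ?_).symm
  intro z hz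
  have hloc : h =ᶠ[𝓝 z] fun _ => 0 := by
    filter_upwards [isClosed_closure.isOpen_compl.mem_nhds hz.2, hΩ.mem_nhds (hKΩ hz.1)] with y hy hyΩ
    by_contra hne
    exact hy (subset_closure ⟨hyΩ, hne⟩)
  rw [hloc.fderiv_eq, hloc.eq_of_nhds]
  simp

end Variation

/-! ### The geometry of strips -/

/-- The quadratic polynomial `g u²/2 + f u + c`. -/
noncomputable def quad (g f c u : ℝ) : ℝ := g * (u ^ 2 / 2) + f * u + c

/-- Twice `quad` is the quadratic form of the matrix `A` with rows `(g, f)` and `(f, 2c)` at `x =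
(u, 1)`. Its smallest eigenvalue is at least determinant over trace; concretely, Cayley–Hamilton
gives `0 ≤ |A x|² = tr A ⟨A x, x⟩ - det A |x|²`. -/
theorem quad_lower {g f c : ℝ} (hg : 0 < g) (h : f ^ 2 < 2 * c * g) (u : ℝ) :
    (2 * c * g - f ^ 2) / (2 * (g + 2 * c)) * (1 + u ^ 2) ≤ quad g f c u := by
  have hc : 0 < c := by
    by_contra hc
    nlinarith [sq_nonneg f, mul_nonneg hg.le (not_lt.1 hc |> neg_nonneg.2)]
  have h2 : 0 < 2 * (g + 2 * c) := by positivity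
  rw [div_mul_eq_mul_div, div_le_iff₀ h2, quad]
  nlinarith [sq_nonneg (g * u + f), sq_nonneg (f * u + 2 * c)]

theorem quad_pos {g f c : ℝ} (hg : 0 < g) (h : f ^ 2 < 2 * c * g) (u : ℝ) : 0 < quad g f c u := by
  have hc : 0 < c := by
    by_contra hc
    nlinarith [sq_nonneg f, mul_nonneg hg.le (not_lt.1 hc |> neg_nonneg.2)]
  have h2 : 0 < 2 * (g + 2 * c) := by positivity
  refine lt_of_lt_of_le ?_ (quad_lower hg h u)
  have : 0 < 2 * c * g - f ^ 2 := by linarith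
  positivity

/-- The Jacobian determinant `∂v/∂s` of `Ψ`. -/
noncomputable def stripQ (F G σ : ℝ → ℝ) (w : ℝ × ℝ) : ℝ :=
  quad (deriv G w.2) (deriv F w.2) (deriv σ w.2) w.1

/-- The derivative of `Ψ`. -/
noncomputable def psiDeriv (F G σ : ℝ → ℝ) (w : ℝ × ℝ) : ℝ × ℝ →L[ℝ] ℝ × ℝ :=
  (Matrix.toLin (.finTwoProd ℝ) (.finTwoProd ℝ)
    !![1, 0; F w.2 + w.1 * G w.2, stripQ F G σ w]).toContinuousLinearMap

theorem psiDeriv_apply (F G σ : ℝ → ℝ) (w y : ℝ × ℝ) :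
    psiDeriv F G σ w y = (y.1, (F w.2 + w.1 * G w.2) * y.1 + stripQ F G σ w * y.2) := by
  rw [psiDeriv, Matrix.toLin_finTwoProd_toContinuousLinearMap]
  simp

theorem det_psiDeriv (F G σ : ℝ → ℝ) (w : ℝ × ℝ) :
    (psiDeriv F G σ w).det = stripQ F G σ w := by
  unfold psiDeriv
  simp [LinearMap.det_toContinuousLinearMap, LinearMap.det_toLin, Matrix.det_fin_two_of]

theorem isOpen_stripJ (ε : ℝ) : IsOpen (stripJ ε) := isOpen_Ioo

theorem isOpen_univ_prod_stripJ (ε : ℝ) : IsOpen ((univ : Set ℝ) ×ˢ stripJ ε) :=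
  isOpen_univ.prod (isOpen_stripJ ε)

theorem ContDiffOn.hasDerivAt_stripJ {ε : ℝ} {F : ℝ → ℝ} (h : ContDiffOn ℝ 2 F (stripJ ε)) {s : ℝ}
    (hs : s ∈ stripJ ε) : HasDerivAt F (deriv F s) s :=
  ((h.differentiableOn two_ne_zero).differentiableAt ((isOpen_stripJ ε).mem_nhds hs)).hasDerivAt

theorem ContDiffOn.continuousOn_deriv_stripJ {ε : ℝ} {F : ℝ → ℝ}
    (h : ContDiffOn ℝ 2 F (stripJ ε)) : ContinuousOn (deriv F) (stripJ ε) :=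
  h.continuousOn_deriv_of_isOpen (isOpen_stripJ ε) (by norm_num)

namespace Heisenberg.IsStrictStrip

variable {ε : ℝ} {F G σ : ℝ → ℝ} {S : Set H1}

theorem hasFDerivAt_Psi (hS : IsStrictStrip ε F G σ S) {w : ℝ × ℝ} (hw : w.2 ∈ stripJ ε) :
    HasFDerivAt (Psi F G σ) (psiDeriv F G σ w) w := by
  have hF := (hS.contDiffOn_F.hasDerivAt_stripJ hw).comp_hasFDerivAt w
    (hasFDerivAt_snd (𝕜 := ℝ) (p := w))
  have hG := (hS.contDiffOn_G.hasDerivAt_stripJ hw).comp_hasFDerivAt w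
    (hasFDerivAt_snd (𝕜 := ℝ) (p := w))
  have hσ := (hS.contDiffOn_σ.hasDerivAt_stripJ hw).comp_hasFDerivAt w
    (hasFDerivAt_snd (𝕜 := ℝ) (p := w))
  have h1 := hasFDerivAt_fst (𝕜 := ℝ) (p := w)
  have h := h1.prodMk (((hG.mul ((h1.pow 2).mul_const (2 : ℝ)⁻¹)).add (hF.mul h1)).add hσ)
  refine h.congr_fderiv ?_ |>.congr_of_eventuallyEq ?_
  · ext <;> simp [psiDeriv_apply, stripQ, quad] <;> ring
  · refine Eventually.of_forall fun y => ?_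
    ext <;> simp [Psi, div_eq_mul_inv]

theorem contDiffOn_Psi (hS : IsStrictStrip ε F G σ S) :
    ContDiffOn ℝ 2 (Psi F G σ) (univ ×ˢ stripJ ε) := by
  have key : ∀ {f : ℝ → ℝ}, ContDiffOn ℝ 2 f (stripJ ε) →
      ContDiffOn ℝ 2 (fun w : ℝ × ℝ => f w.2) (univ ×ˢ stripJ ε) := fun hf =>
    hf.comp contDiffOn_snd fun w hw => hw.2
  have h1 := key hS.contDiffOn_F
  have h2 := key hS.contDiffOn_G
  have h3 := key hS.contDiffOn_σ
  unfold Psi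
  have h4 : ContDiffOn ℝ 2 (fun w : ℝ × ℝ => w.1) (univ ×ˢ stripJ ε) := contDiffOn_fst
  exact h4.prodMk (((h2.mul ((h4.pow 2).div_const 2)).add (h1.mul h4)).add h3)

theorem PsiInv_Psi (hS : IsStrictStrip ε F G σ S) {w : ℝ × ℝ} (hw : w.2 ∈ stripJ ε) :
    PsiInv ε F G σ (Psi F G σ w) = w :=
  hS.injOn.leftInvOn_invFunOn ⟨mem_univ _, hw⟩

theorem stripPhi_Psi (hS : IsStrictStrip ε F G σ S) {w : ℝ × ℝ} (hw : w.2 ∈ stripJ ε) :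
    stripPhi ε F G σ (Psi F G σ w) = F w.2 + w.1 * G w.2 := by
  rw [stripPhi, hS.PsiInv_Psi hw]
  rfl

theorem PsiInv_mem {z : ℝ × ℝ} (hz : z ∈ stripDomain ε F G σ) :
    (PsiInv ε F G σ z).2 ∈ stripJ ε := (Function.invFunOn_mem hz).2

theorem Psi_PsiInv {z : ℝ × ℝ} (hz : z ∈ stripDomain ε F G σ) :
    Psi F G σ (PsiInv ε F G σ z) = z := Function.invFunOn_eq hz

section Positive

variable (hS : IsStrictStrip ε F G σ S) (hG : ∀ s ∈ stripJ ε, 0 < deriv G s)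
include hS hG

theorem stripQ_pos {w : ℝ × ℝ} (hw : w.2 ∈ stripJ ε) : 0 < stripQ F G σ w :=
  quad_pos (hG _ hw) (hS.strict _ hw) _

theorem exists_psiEquiv {w : ℝ × ℝ} (hw : w.2 ∈ stripJ ε) :
    ∃ e : (ℝ × ℝ) ≃L[ℝ] (ℝ × ℝ), HasFDerivAt (Psi F G σ) (e : ℝ × ℝ →L[ℝ] ℝ × ℝ) w := by
  have h0 : (psiDeriv F G σ w).det ≠ 0 := by
    rw [det_psiDeriv]
    exact (hS.stripQ_pos hG hw).ne'
  exact ⟨(psiDeriv F G σ w).toContinuousLinearEquivOfDetNeZero h0, hS.hasFDerivAt_Psi hw⟩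

theorem isOpen_stripDomain : IsOpen (stripDomain ε F G σ) := by
  rw [isOpen_iff_mem_nhds]
  rintro _ ⟨w, hw, rfl⟩
  obtain ⟨e, he⟩ := hS.exists_psiEquiv hG hw.2
  have hU := (isOpen_univ_prod_stripJ ε).mem_nhds hw
  have hs := (hS.contDiffOn_Psi.contDiffAt hU).hasStrictFDerivAt' he two_ne_zero
  rw [← hs.map_nhds_eq_of_equiv]
  exact image_mem_map hU

/-- The inverse function theorem gives `C²` local inverses because the Jacobian `stripQ` is
positive; global injectivity of `Psi` identifies each of them with `PsiInv` near the given point. -/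
theorem contDiffOn_PsiInv : ContDiffOn ℝ 2 (PsiInv ε F G σ) (stripDomain ε F G σ) := by
  rintro _ ⟨w, hw, rfl⟩
  obtain ⟨e, he⟩ := hS.exists_psiEquiv hG hw.2
  have hU := (isOpen_univ_prod_stripJ ε).mem_nhds hw
  have hc := hS.contDiffOn_Psi.contDiffAt hU
  have hs := hc.hasStrictFDerivAt' he two_ne_zero
  have hinv := hc.to_localInverse he two_ne_zero
  refine (hinv.congr_of_eventuallyEq ?_).contDiffWithinAt
  have h1 := hs.eventually_right_inverse
  have h2 : ∀ᶠ z in 𝓝 (Psi F G σ w), hs.localInverse _ _ _ z ∈ (univ : Set ℝ) ×ˢ stripJ ε := by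
    have := hs.localInverse_continuousAt
    refine this.eventually_mem ?_
    rw [hs.localInverse_apply_image]
    exact hU
  filter_upwards [h1, h2] with z hz1 hz2
  conv_lhs => rw [← hz1]
  exact hS.PsiInv_Psi hz2.2

theorem contDiffOn_comp_PsiInv {H : ℝ × ℝ → ℝ} (hH : ContDiffOn ℝ 2 H (univ ×ˢ stripJ ε)) :
    ContDiffOn ℝ 2 (fun z => H (PsiInv ε F G σ z)) (stripDomain ε F G σ) :=
  hH.comp (hS.contDiffOn_PsiInv hG) fun _ hz => ⟨mem_univ _, PsiInv_mem hz⟩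

theorem contDiffOn_stripPhi : ContDiffOn ℝ 2 (stripPhi ε F G σ) (stripDomain ε F G σ) := by
  have h := hS.contDiffOn_PsiInv hG
  have h2 : ContDiffOn ℝ 2 (fun z => (PsiInv ε F G σ z).2) (stripDomain ε F G σ) := h.snd
  exact (hS.contDiffOn_F.comp h2 fun _ hz => PsiInv_mem hz).add
    (contDiffOn_fst.mul (hS.contDiffOn_G.comp h2 fun _ hz => PsiInv_mem hz))

/-- Derivatives of `k` in the `(u, v)`-plane, in terms of those of `k ∘ Ψ`. -/
theorem fderiv_of_comp_Psi {k H : ℝ × ℝ → ℝ} {H' : ℝ × ℝ →L[ℝ] ℝ} {w : ℝ × ℝ}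
    (hw : w.2 ∈ stripJ ε) (hk : DifferentiableOn ℝ k (stripDomain ε F G σ))
    (hH : HasFDerivAt H H' w) (hkH : ∀ y : ℝ × ℝ, y.2 ∈ stripJ ε → k (Psi F G σ y) = H y) :
    fderiv ℝ k (Psi F G σ w) (1, 0) + stripPhi ε F G σ (Psi F G σ w) *
      fderiv ℝ k (Psi F G σ w) (0, 1) = H' (1, 0) ∧
    stripQ F G σ w * fderiv ℝ k (Psi F G σ w) (0, 1) = H' (0, 1) := by
  have hz : Psi F G σ w ∈ stripDomain ε F G σ := ⟨w, ⟨mem_univ _, hw⟩, rfl⟩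
  have dk := (hk.differentiableAt ((hS.isOpen_stripDomain hG).mem_nhds hz)).hasFDerivAt
  have hcomp := dk.comp w (hS.hasFDerivAt_Psi hw)
  have heq : k ∘ Psi F G σ =ᶠ[𝓝 w] H := by
    filter_upwards [(isOpen_univ_prod_stripJ ε).mem_nhds 
      (⟨mem_univ _, hw⟩ : w ∈ (univ : Set ℝ) ×ˢ stripJ ε)] with y hy
    exact hkH y hy.2
  have h := (hcomp.congr_of_eventuallyEq heq.symm).unique hH
  have hlin : ∀ a b : ℝ, fderiv ℝ k (Psi F G σ w) (a, b) =
      a * fderiv ℝ k (Psi F G σ w) (1, 0) + b * fderiv ℝ k (Psi F G σ w) (0, 1) := by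
    intro a b
    have : ((a, b) : ℝ × ℝ) = a • (1, 0) + b • (0, 1) := by ext <;> simp
    rw [this, map_add, map_smul, map_smul]
    simp
  rw [← h, hS.stripPhi_Psi hw]
  simp only [ContinuousLinearMap.comp_apply, psiDeriv_apply]
  constructor
  · simp [hlin 1 (F w.2 + w.1 * G w.2)]
  · simp [hlin 0 (stripQ F G σ w)]

theorem fderiv_stripPhi_Psi {w : ℝ × ℝ} (hw : w.2 ∈ stripJ ε) :
    fderiv ℝ (stripPhi ε F G σ) (Psi F G σ w) (1, 0) + stripPhi ε F G σ (Psi F G σ w) *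
      fderiv ℝ (stripPhi ε F G σ) (Psi F G σ w) (0, 1) = G w.2 ∧
    stripQ F G σ w * fderiv ℝ (stripPhi ε F G σ) (Psi F G σ w) (0, 1) =
      deriv F w.2 + w.1 * deriv G w.2 := by
  have hF := (hS.contDiffOn_F.hasDerivAt_stripJ hw).comp_hasFDerivAt w
    (hasFDerivAt_snd (𝕜 := ℝ) (p := w))
  have hG' := (hS.contDiffOn_G.hasDerivAt_stripJ hw).comp_hasFDerivAt w
    (hasFDerivAt_snd (𝕜 := ℝ) (p := w))
  have h := hF.add ((hasFDerivAt_fst (𝕜 := ℝ) (p := w)).mul hG')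
  have key := hS.fderiv_of_comp_Psi hG hw
    ((hS.contDiffOn_stripPhi hG).differentiableOn two_ne_zero) h (fun y hy => hS.stripPhi_Psi hy)
  simpa using key

end Positive

end Heisenberg.IsStrictStrip

/-! ### The second variation of a strip in the parameters `(u, s)` -/

/-- Rests on `(x / √(1 + x²))' = (1 + x²)^{-3/2}`. It is the primitive behind the integration by
parts in `s`, and explains why both terms of the final density carry the same weight. -/
theorem hasDerivAt_div_sqrt {f h : ℝ → ℝ} {f' h' s : ℝ} (hf : HasDerivAt f f' s)
    (hh : HasDerivAt h h' s) :
    HasDerivAt (fun s => f s / √(1 + f s ^ 2) * h s ^ 2)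
      (2 * f s * (h s * h') / √(1 + f s ^ 2) + f' * h s ^ 2 / √(1 + f s ^ 2) ^ 3) s := by
  have hpos : 0 < 1 + f s ^ 2 := by positivity
  have h1 := ((hf.pow 2).const_add 1).sqrt (f := fun s => 1 + f s ^ 2) hpos.ne'
  have hs : 0 < √(1 + f s ^ 2) := Real.sqrt_pos.2 hpos
  have hsq : √(1 + f s ^ 2) ^ 2 = 1 + f s ^ 2 := Real.sq_sqrt hpos.le
  have h2 := (hf.div h1 hs.ne').mul (hh.pow 2)
  refine h2.congr_deriv ?_
  simp only [Pi.div_apply, Pi.pow_apply]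
  field_simp
  rw [hsq]
  push_cast
  ring

theorem hasDerivAt_snd_of_differentiableAt {H : ℝ × ℝ → ℝ} {u s : ℝ}
    (h : DifferentiableAt ℝ H (u, s)) :
    HasDerivAt (fun s => H (u, s)) (fderiv ℝ H (u, s) (0, 1)) s :=
  h.hasFDerivAt.comp_hasDerivAt s ((hasDerivAt_const s u).prodMk (hasDerivAt_id s))

namespace Heisenberg.IsStrictStrip

variable {ε : ℝ} {F G σ : ℝ → ℝ} {S : Set H1}

theorem C20_comp_PsiInv (hS : IsStrictStrip ε F G σ S) (hG : ∀ s ∈ stripJ ε, 0 < deriv G s)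
    {H : ℝ × ℝ → ℝ} (hH : ContDiffOn ℝ 2 H (univ ×ˢ stripJ ε)) {R : Set (ℝ × ℝ)}
    (hR : IsCompact R) (hRJ : R ⊆ univ ×ˢ stripJ ε) (h0 : ∀ w, w ∉ R → H w = 0) :
    C20 S (fun g => H (PsiInv ε F G σ (coord g))) := by
  have hcφ := (hS.contDiffOn_stripPhi hG).continuousOn
  have hRΩ : Psi F G σ '' R ⊆ stripDomain ε F G σ := image_mono hRJ
  rw [hS.eq_graph]
  refine ⟨?_, graphMap (stripPhi ε F G σ) '' (Psi F G σ '' R), image_mono hRΩ, ?_, ?_⟩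
  · rw [graphDomain_graph]
    refine (hS.contDiffOn_comp_PsiInv hG hH).congr fun z hz => ?_
    rw [param_graph _ _ hz]
    simp only [coord_graphMap]
  · refine (hR.image_of_continuousOn (hS.contDiffOn_Psi.continuousOn.mono hRJ)).image_of_continuousOn
      (ContinuousOn.mono ?_ hRΩ)
    rw [show graphMap (stripPhi ε F G σ) = fun z => (stripPhi ε F G σ z, z.1,
      z.2 - z.1 / 2 * stripPhi ε F G σ z) from funext fun z => graphMap_eq _ z.1 z.2]
    fun_prop
  · rintro _ ⟨⟨z, hz, rfl⟩, hn⟩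
    refine h0 _ fun hzR => hn ⟨z, ⟨_, hzR, ?_⟩, rfl⟩
    rw [coord_graphMap, Psi_PsiInv hz]

/-- The second variation of a strip, after the change of variables `Ψ`. -/
theorem secondVariation_comp_PsiInv (hS : IsStrictStrip ε F G σ S)
    (hG : ∀ s ∈ stripJ ε, 0 < deriv G s) {H : ℝ × ℝ → ℝ}
    (hH : ContDiffOn ℝ 2 H (univ ×ˢ stripJ ε)) {R : Set (ℝ × ℝ)}
    (hR : IsCompact R) (hRJ : R ⊆ univ ×ˢ stripJ ε) (h0 : ∀ w, w ∉ R → H w = 0) :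
    ContDiff ℝ 2 (perimeterVariation S (fieldX1 fun g => H (PsiInv ε F G σ (coord g)))) ∧
    secondVariation S (fieldX1 fun g => H (PsiInv ε F G σ (coord g))) =
      ∫ w in R, ((fderiv ℝ H w (1, 0) + H w * (deriv F w.2 + w.1 * deriv G w.2) /
          stripQ F G σ w) ^ 2 * stripQ F G σ w / √(1 + G w.2 ^ 2) ^ 3 +
        2 * G w.2 * (H w * fderiv ℝ H w (0, 1)) / √(1 + G w.2 ^ 2)) := by
  have hRΩ : Psi F G σ '' R ⊆ stripDomain ε F G σ := image_mono hRJ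
  have hh := (hS.contDiffOn_comp_PsiInv hG hH)
  have key := secondVariation_fieldX1_graph (hS.isOpen_stripDomain hG)
    ((hS.contDiffOn_stripPhi hG).of_le one_le_two)
    (ψ := fun g => H (PsiInv ε F G σ (coord g))) (h := fun z => H (PsiInv ε F G σ z))
    (fun z _ => by rw [coord_graphMap]) (hh.of_le one_le_two)
    (hR.image_of_continuousOn (hS.contDiffOn_Psi.continuousOn.mono hRJ)) hRΩ
    (fun z hz hzR => h0 _ fun hz' => hzR ⟨_, hz', Psi_PsiInv hz⟩)
  rw [← hS.eq_graph] at key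
  refine ⟨key.1, key.2.trans ?_⟩
  rw [integral_image_eq_integral_abs_det_fderiv_smul volume hR.isClosed.measurableSet
    (fun w hw => (hS.hasFDerivAt_Psi (hRJ hw).2).hasFDerivWithinAt) (hS.injOn.mono hRJ)]
  refine setIntegral_congr_fun hR.isClosed.measurableSet fun w hw => ?_
  have hwJ := (hRJ hw).2
  have hQ := hS.stripQ_pos hG hwJ
  have hHd := ((hH.differentiableOn two_ne_zero).differentiableAt
    ((isOpen_univ_prod_stripJ ε).mem_nhds (hRJ hw))).hasFDerivAt
  obtain ⟨e1, e2⟩ := hS.fderiv_stripPhi_Psi hG hwJ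
  obtain ⟨e3, e4⟩ := hS.fderiv_of_comp_Psi hG hwJ (hh.differentiableOn two_ne_zero) hHd
    (fun y hy => by rw [hS.PsiInv_Psi hy])
  have e5 : H (PsiInv ε F G σ (Psi F G σ w)) = H w := by rw [hS.PsiInv_Psi hwJ]
  simp only [det_psiDeriv, abs_of_pos hQ, smul_eq_mul]
  -- Writing `H_s` and `F' + u G'` as `stripQ` times the `v`-derivatives of the transported function
  -- and of `φ` makes the Jacobian cancel where it should.
  rw [e1, e3, e5, ← e4, ← e2]
  have hs : 0 < √(1 + G w.2 ^ 2) := Real.sqrt_pos.2 (by positivity)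
  field_simp

/-- Integration by parts in `s`. -/
theorem integral_parts (hS : IsStrictStrip ε F G σ S) {H : ℝ × ℝ → ℝ}
    (hH : ContDiffOn ℝ 2 H (univ ×ˢ stripJ ε)) {a b : ℝ} (hb : 0 ≤ b) (hbε : b < 4 * ε)
    (h0 : ∀ w, b ≤ |w.2| → H w = 0) :
    ∫ w in Icc (-a) a ×ˢ Icc (-b) b, (2 * G w.2 * (H w * fderiv ℝ H w (0, 1)) / √(1 + G w.2 ^ 2) +
      deriv G w.2 * H w ^ 2 / √(1 + G w.2 ^ 2) ^ 3) = 0 ∧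
    IntegrableOn (fun w => (2 * G w.2 * (H w * fderiv ℝ H w (0, 1)) / √(1 + G w.2 ^ 2) +
      deriv G w.2 * H w ^ 2 / √(1 + G w.2 ^ 2) ^ 3)) (Icc (-a) a ×ˢ Icc (-b) b) := by
  have hbJ : Icc (-b) b ⊆ stripJ ε := fun s hs => ⟨by linarith [hs.1], by linarith [hs.2]⟩
  have hRJ : Icc (-a) a ×ˢ Icc (-b) b ⊆ univ ×ˢ stripJ ε := prod_mono (subset_univ _) hbJ
  have lift : ∀ {f : ℝ → ℝ}, ContinuousOn f (stripJ ε) →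
      ContinuousOn (fun w : ℝ × ℝ => f w.2) (univ ×ˢ stripJ ε) := fun hf =>
    hf.comp continuousOn_snd fun w hw => hw.2
  have cG := lift hS.contDiffOn_G.continuousOn
  have cG' := lift hS.contDiffOn_G.continuousOn_deriv_stripJ
  have cH := hH.continuousOn
  have cH' : ContinuousOn (fun w => fderiv ℝ H w (0, 1)) (univ ×ˢ stripJ ε) :=
    (hH.continuousOn_fderiv_of_isOpen (isOpen_univ_prod_stripJ ε) one_le_two).clm_apply
      continuousOn_const
  have hs : ∀ x : ℝ, √(1 + x ^ 2) ≠ 0 := fun x => (Real.sqrt_pos.2 (by positivity)).ne'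
  have cS : ContinuousOn (fun w : ℝ × ℝ => √(1 + G w.2 ^ 2)) (univ ×ˢ stripJ ε) :=
    (continuousOn_const.add (cG.pow 2)).sqrt
  have cE : ContinuousOn (fun w => (2 * G w.2 * (H w * fderiv ℝ H w (0, 1)) / √(1 + G w.2 ^ 2) +
      deriv G w.2 * H w ^ 2 / √(1 + G w.2 ^ 2) ^ 3)) (univ ×ˢ stripJ ε) :=
    (((continuousOn_const.mul cG).mul (cH.mul cH')).div cS fun w _ => hs _).add
      ((cG'.mul (cH.pow 2)).div (cS.pow 3) fun w _ => pow_ne_zero 3 (hs _))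
  have hint := (cE.mono hRJ).integrableOn_compact (μ := volume) (isCompact_Icc.prod isCompact_Icc)
  refine ⟨?_, hint⟩
  rw [Measure.volume_eq_prod] at hint ⊢
  rw [setIntegral_prod _ hint]
  refine (integral_congr_ae (Eventually.of_forall fun u => ?_)).trans (integral_zero _ _)
  rw [integral_Icc_eq_integral_Ioc, ← intervalIntegral.integral_of_le (by linarith)]
  have hder : ∀ s ∈ uIcc (-b) b, HasDerivAt (fun s => G s / √(1 + G s ^ 2) * H (u, s) ^ 2)
      (2 * G s * (H (u, s) * fderiv ℝ H (u, s) (0, 1)) / √(1 + G s ^ 2) +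
        deriv G s * H (u, s) ^ 2 / √(1 + G s ^ 2) ^ 3) s := by
    intro s hs
    rw [uIcc_of_le (by linarith)] at hs
    exact hasDerivAt_div_sqrt (hS.contDiffOn_G.hasDerivAt_stripJ (hbJ hs))
      (hasDerivAt_snd_of_differentiableAt ((hH.differentiableOn two_ne_zero).differentiableAt
        ((isOpen_univ_prod_stripJ ε).mem_nhds ⟨mem_univ _, hbJ hs⟩)))
  have hci : ContinuousOn (fun s => 2 * G s * (H (u, s) * fderiv ℝ H (u, s) (0, 1)) /
      √(1 + G s ^ 2) + deriv G s * H (u, s) ^ 2 / √(1 + G s ^ 2) ^ 3) (uIcc (-b) b) := by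
    rw [uIcc_of_le (by linarith)]
    exact cE.comp (f := fun s => (u, s)) (by fun_prop) fun s hs => ⟨mem_univ _, hbJ hs⟩
  -- The boundary terms vanish because `h0` includes the endpoints `|s| = b`.
  rw [intervalIntegral.integral_eq_sub_of_hasDerivAt hder hci.intervalIntegrable,
    h0 (u, b) (le_abs_self b), h0 (u, -b) (by simp [le_abs_self])]
  simp

/-- The second variation of a strip in the direction `ψ X₁`, where `ψ` is the function `H` of the
parameters `(u, s)`. -/
theorem secondVariation_eq (hS : IsStrictStrip ε F G σ S)
    (hG : ∀ s ∈ stripJ ε, 0 < deriv G s) {H : ℝ × ℝ → ℝ}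
    (hH : ContDiffOn ℝ 2 H (univ ×ˢ stripJ ε)) {a b : ℝ} (hb : 0 ≤ b) (hbε : b < 4 * ε)
    (h0 : ∀ w, b ≤ |w.2| → H w = 0) (h0' : ∀ w, a ≤ |w.1| → H w = 0) :
    C20 S (fun g => H (PsiInv ε F G σ (coord g))) ∧
    ContDiff ℝ 2 (perimeterVariation S (fieldX1 fun g => H (PsiInv ε F G σ (coord g)))) ∧
    secondVariation S (fieldX1 fun g => H (PsiInv ε F G σ (coord g))) =
      ∫ w in Icc (-a) a ×ˢ Icc (-b) b, ((fderiv ℝ H w (1, 0) +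
          H w * (deriv F w.2 + w.1 * deriv G w.2) / stripQ F G σ w) ^ 2 * stripQ F G σ w -
        deriv G w.2 * H w ^ 2) / √(1 + G w.2 ^ 2) ^ 3 := by
  have hbJ : Icc (-b) b ⊆ stripJ ε := fun s hs => ⟨by linarith [hs.1], by linarith [hs.2]⟩
  have hRJ : Icc (-a) a ×ˢ Icc (-b) b ⊆ univ ×ˢ stripJ ε := prod_mono (subset_univ _) hbJ
  have hR : IsCompact (Icc (-a) a ×ˢ Icc (-b) b) := isCompact_Icc.prod isCompact_Icc
  have hout : ∀ w, w ∉ Icc (-a) a ×ˢ Icc (-b) b → H w = 0 := by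
    intro w hw
    by_cases h1 : a ≤ |w.1|
    · exact h0' w h1
    by_cases h2 : b ≤ |w.2|
    · exact h0 w h2
    · exact absurd ⟨abs_le.1 (not_le.1 h1).le, abs_le.1 (not_le.1 h2).le⟩ hw
  obtain ⟨hc, hv⟩ := hS.secondVariation_comp_PsiInv hG hH hR hRJ hout
  refine ⟨hS.C20_comp_PsiInv hG hH hR hRJ hout, hc, hv.trans ?_⟩
  obtain ⟨hp, hi⟩ := hS.integral_parts hH (a := a) hb hbε h0
  have lift : ∀ {f : ℝ → ℝ}, ContinuousOn f (stripJ ε) →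
      ContinuousOn (fun w : ℝ × ℝ => f w.2) (univ ×ˢ stripJ ε) := fun hf =>
    hf.comp continuousOn_snd fun w hw => hw.2
  have cG := lift hS.contDiffOn_G.continuousOn
  have cG' := lift hS.contDiffOn_G.continuousOn_deriv_stripJ
  have cF' := lift hS.contDiffOn_F.continuousOn_deriv_stripJ
  have cσ' := lift hS.contDiffOn_σ.continuousOn_deriv_stripJ
  have cH := hH.continuousOn
  have cH' : ContinuousOn (fun w => fderiv ℝ H w (1, 0)) (univ ×ˢ stripJ ε) :=
    (hH.continuousOn_fderiv_of_isOpen (isOpen_univ_prod_stripJ ε) one_le_two).clm_apply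
      continuousOn_const
  have hs : ∀ x : ℝ, √(1 + x ^ 2) ≠ 0 := fun x => (Real.sqrt_pos.2 (by positivity)).ne'
  have cS : ContinuousOn (fun w : ℝ × ℝ => √(1 + G w.2 ^ 2)) (univ ×ˢ stripJ ε) :=
    (continuousOn_const.add (cG.pow 2)).sqrt
  have cQ : ContinuousOn (stripQ F G σ) (univ ×ˢ stripJ ε) := by
    unfold stripQ quad
    fun_prop
  have cE : ContinuousOn (fun w => ((fderiv ℝ H w (1, 0) +
          H w * (deriv F w.2 + w.1 * deriv G w.2) / stripQ F G σ w) ^ 2 * stripQ F G σ w -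
        deriv G w.2 * H w ^ 2) / √(1 + G w.2 ^ 2) ^ 3) (univ ×ˢ stripJ ε) :=
    (((((cH'.add ((cH.mul (cF'.add (continuousOn_fst.mul cG'))).div cQ
      fun w hw => (hS.stripQ_pos hG hw.2).ne')).pow 2).mul cQ).sub (cG'.mul (cH.pow 2))).div
      (cS.pow 3) fun w _ => pow_ne_zero 3 (hs _))
  -- The integrand of `secondVariation_comp_PsiInv` is the claimed one plus the exact `s`-derivative
  -- from `integral_parts`, whose integral is zero.
  have hsum := integral_add ((cE.mono hRJ).integrableOn_compact (μ := volume) hR) hi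
  rw [hp, add_zero] at hsum
  rw [← hsum]
  refine setIntegral_congr_fun hR.isClosed.measurableSet fun w hw => ?_
  ring

end Heisenberg.IsStrictStrip

/-! ### Regularization -/

theorem exists_contDiff_extension {f : ℝ → ℝ} {A b : ℝ} (hf : ContDiffOn ℝ 2 f (Ioo (-A) A))
    (hb : 0 < b) (hbA : b < A) :
    ∃ g : ℝ → ℝ, ContDiff ℝ 2 g ∧ HasCompactSupport g ∧ ∀ s, |s| ≤ b → g s = f s := by
  let φ : ContDiffBump (0 : ℝ) := ⟨b, (b + A) / 2, hb, by linarith⟩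
  refine ⟨fun s => φ s * f s, ?_, φ.hasCompactSupport.mul_right, fun s hs => ?_⟩
  · rw [contDiff_iff_contDiffAt]
    intro s
    by_cases hs : s ∈ Ioo (-A) A
    · exact φ.contDiffAt.mul (hf.contDiffAt (isOpen_Ioo.mem_nhds hs))
    · have hs' : A ≤ |s| := by
        by_contra h
        exact hs (abs_lt.1 (not_le.1 h))
      have hev : ∀ᶠ t in 𝓝 s, (b + A) / 2 < |t| :=
        continuous_abs.continuousAt.eventually_const_lt (by linarith)
      refine (contDiffAt_const (c := (0 : ℝ))).congr_of_eventuallyEq ?_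
      filter_upwards [hev] with t ht
      rw [φ.zero_of_le_dist (by rw [Real.dist_eq, sub_zero]; exact ht.le), zero_mul]
  · simp only
    rw [φ.one_of_mem_closedBall (by rw [mem_closedBall_zero_iff]; exact hs), one_mul]

theorem mollify_eq_convolution (ζ : ℝ → ℝ) (k : ℕ) (f : ℝ → ℝ) :
    mollify ζ k f = convolution f (fun t : ℝ => (k : ℝ) * ζ (k * t))
      (ContinuousLinearMap.mul ℝ ℝ) volume := by
  ext s
  simp [mollify, convolution]

namespace Heisenberg.IsMollifier

variable {ζ : ℝ → ℝ} (hζ : IsMollifier ζ)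
include hζ

theorem eq_zero_of_lt {t : ℝ} (ht : 1 < |t|) : ζ t = 0 := by
  refine image_eq_zero_of_notMem_tsupport ?_
  rw [hζ.tsupport_eq]
  exact fun h => absurd (abs_le.2 h) (not_le.2 ht)

theorem scaled_eq_zero {k : ℕ} (hk : 0 < k) {t : ℝ} (ht : (1 : ℝ) / k < |t|) :
    (k : ℝ) * ζ (k * t) = 0 := by
  have hk' : (0 : ℝ) < k := by exact_mod_cast hk
  rw [hζ.eq_zero_of_lt, mul_zero]
  rw [abs_mul, abs_of_pos hk']
  rwa [div_lt_iff₀' hk'] at ht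

theorem scaled_hasCompactSupport {k : ℕ} (hk : 0 < k) :
    HasCompactSupport fun t : ℝ => (k : ℝ) * ζ (k * t) := by
  refine HasCompactSupport.intro (isCompact_closedBall (0 : ℝ) (1 / k)) fun t ht => ?_
  refine hζ.scaled_eq_zero hk ?_
  rwa [mem_closedBall_zero_iff, not_le] at ht

theorem scaled_contDiff (k : ℕ) : ContDiff ℝ 3 fun t : ℝ => (k : ℝ) * ζ (k * t) := by
  have h : ContDiff ℝ 3 ζ := by exact_mod_cast contDiff_infty.1 hζ.smooth 3
  exact contDiff_const.mul (h.comp (contDiff_const.mul contDiff_id))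

theorem scaled_integral {k : ℕ} (hk : 0 < k) : ∫ t : ℝ, (k : ℝ) * ζ (k * t) = 1 := by
  have hk' : (0 : ℝ) < k := by exact_mod_cast hk
  rw [integral_const_mul, Measure.integral_comp_mul_left, hζ.integral_eq, abs_of_pos (by positivity)]
  simp [hk'.ne']

theorem contDiff_mollify {k : ℕ} (hk : 0 < k) {f : ℝ → ℝ} (hf : Continuous f) :
    ContDiff ℝ 3 (mollify ζ k f) := by
  rw [mollify_eq_convolution]
  exact (hζ.scaled_hasCompactSupport hk).contDiff_convolution_right _ hf.locallyIntegrable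
    (hζ.scaled_contDiff k)

theorem deriv_mollify (k : ℕ) {f : ℝ → ℝ} (hf : ContDiff ℝ 1 f) (hc : HasCompactSupport f) :
    deriv (mollify ζ k f) = mollify ζ k (deriv f) := by
  rw [mollify_eq_convolution, mollify_eq_convolution]
  exact funext fun s => (hc.hasDerivAt_convolution_left _ hf
    (hζ.scaled_contDiff k).continuous.locallyIntegrable s).deriv

theorem mollify_congr {k : ℕ} (hk : 0 < k) {f g : ℝ → ℝ} {s : ℝ}
    (h : ∀ r, |s - r| ≤ 1 / k → f r = g r) : mollify ζ k f s = mollify ζ k g s := by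
  refine integral_congr_ae (Eventually.of_forall fun r => ?_)
  by_cases hr : |s - r| ≤ 1 / k
  · simp only [h r hr]
  · simp only [hζ.scaled_eq_zero hk (not_le.1 hr), mul_zero]

theorem abs_mollify_sub_le {k : ℕ} (hk : 0 < k) {g : ℝ → ℝ} (hg : Continuous g) {s e : ℝ}
    (h : ∀ r, |s - r| ≤ 1 / k → |g r - g s| ≤ e) : |mollify ζ k g s - g s| ≤ e := by
  set κ : ℝ → ℝ := fun t => (k : ℝ) * ζ (k * t) with hκ
  have cκ : Continuous κ := (hζ.scaled_contDiff k).continuous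
  have sκ : HasCompactSupport κ := hζ.scaled_hasCompactSupport hk
  have iκ : Integrable (fun r => κ (s - r)) := (cκ.integrable_of_hasCompactSupport sκ).comp_sub_left s
  have one : ∫ r, κ (s - r) = 1 := by
    rw [integral_sub_left_eq_self]
    exact hζ.scaled_integral hk
  have igκ : Integrable (fun r => g r * κ (s - r)) := by
    refine (hg.mul (by fun_prop)).integrable_of_hasCompactSupport ?_
    refine HasCompactSupport.mul_left ?_
    exact sκ.comp_homeomorph (Homeomorph.subLeft s)
  have e1 : mollify ζ k g s - g s = ∫ r, (g r - g s) * κ (s - r) := by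
    have : ∫ r, (g r - g s) * κ (s - r) = ∫ r, (g r * κ (s - r) - g s * κ (s - r)) := by
      congr 1; ext r; ring
    rw [this, integral_sub igκ (iκ.const_mul _), integral_const_mul, one, mul_one]
    rfl
  rw [e1]
  refine (norm_integral_le_of_norm_le (f := fun r => (g r - g s) * κ (s - r))
    (iκ.const_mul e) (Eventually.of_forall fun r => ?_)).trans (le_of_eq ?_)
  · have hn : 0 ≤ κ (s - r) := mul_nonneg (by positivity) (hζ.nonneg _)
    simp only [norm_mul, Real.norm_of_nonneg hn]
    by_cases hr : |s - r| ≤ 1 / k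
    · exact mul_le_mul_of_nonneg_right (h r hr) hn
    · simp only [hκ, hζ.scaled_eq_zero hk (not_le.1 hr), mul_zero, le_refl]
  · rw [integral_const_mul, one, mul_one]

/-- On a compact part of the interval on which `f` is of class `C²`, the regularizations are
eventually smooth, and their derivatives converge uniformly. -/
theorem mollify_spec {f : ℝ → ℝ} {A b : ℝ} (hf : ContDiffOn ℝ 2 f (Ioo (-A) A))
    (hb : 0 < b) (hbA : b < A) :
    (∀ᶠ k : ℕ in atTop, ContDiffOn ℝ 2 (deriv (mollify ζ k f)) (Ioo (-b) b)) ∧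
    ∀ e > 0, ∀ᶠ k : ℕ in atTop, ∀ s ∈ Ioo (-b) b, |deriv (mollify ζ k f) s - deriv f s| ≤ e := by
  obtain ⟨g, hg, hgc, hfg⟩ := exists_contDiff_extension hf (b := (b + A) / 2) (by linarith)
    (by linarith)
  have hg1 : ContDiff ℝ 1 g := hg.of_le one_le_two
  have hgd : Continuous (deriv g) := hg1.continuous_deriv le_rfl
  have small : ∀ η : ℝ, 0 < η → ∀ᶠ k : ℕ in atTop, 0 < k ∧ (1 : ℝ) / k < η := by
    intro η hη
    filter_upwards [eventually_gt_atTop 0,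
      (tendsto_one_div_atTop_nhds_zero_nat (𝕜 := ℝ)).eventually_lt_const hη] with k h1 h2
    exact ⟨h1, h2⟩
  -- Nothing is known of `f` outside `(-A, A)`. Once `1/k` is below the margin `(A - b)/2`, the
  -- mollification on `(-b, b)` sees only points with `|r| ≤ (b + A)/2`, where the global extension
  -- `g` agrees with `f`.
  have heq : ∀ᶠ k : ℕ in atTop, 0 < k ∧ EqOn (mollify ζ k f) (mollify ζ k g) (Ioo (-b) b) := by
    filter_upwards [small ((A - b) / 2) (by linarith)] with k hk
    refine ⟨hk.1, fun s hs => hζ.mollify_congr hk.1 fun r hr => (hfg r ?_).symm⟩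
    have h1 : |s| < b := abs_lt.2 hs
    have h2 : |r| ≤ |s| + |s - r| := by
      have := abs_sub_abs_le_abs_sub r s
      rw [abs_sub_comm r s] at this
      linarith
    linarith [hk.2]
  have hder : ∀ {k : ℕ}, EqOn (mollify ζ k f) (mollify ζ k g) (Ioo (-b) b) →
      EqOn (deriv (mollify ζ k f)) (deriv (mollify ζ k g)) (Ioo (-b) b) := fun h =>
    h.deriv isOpen_Ioo
  constructor
  · filter_upwards [heq] with k hk
    refine ContDiffOn.congr (ContDiff.contDiffOn ?_) (hder hk.2)
    have h3 := hζ.contDiff_mollify hk.1 hg.continuous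
    rw [show (3 : WithTop ℕ∞) = 2 + 1 by norm_num, contDiff_succ_iff_deriv] at h3
    exact h3.2.2
  · intro e he
    have hu := hgc.deriv.uniformContinuous_of_continuous hgd
    obtain ⟨η, hη, hη'⟩ := Metric.uniformContinuous_iff.1 hu e he
    filter_upwards [heq, small η hη] with k hk hk2 s hs
    have hfd : deriv f s = deriv g s := by
      refine Filter.EventuallyEq.deriv_eq ?_
      filter_upwards [isOpen_Ioo.mem_nhds hs] with r hr
      exact (hfg r (by have := abs_lt.2 hr; linarith)).symm
    rw [hder hk.2 hs, hfd, hζ.deriv_mollify k hg1 hgc]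
    refine hζ.abs_mollify_sub_le hk.1 hgd fun r hr => ?_
    refine (hη' (a := r) (b := s) ?_).le
    rw [dist_comm, Real.dist_eq]
    exact hr.trans_lt hk2.2

end Heisenberg.IsMollifier

/-! ### Integrals of quadratic densities -/

/-- The density of the second variation, divided by `χ(s)² (1 + G(s)²)^{-3/2}`: here
`quad g f c` is the Jacobian, `quad g₁ f₁ c₁` its regularization, and `t`, `a` are the value and the
derivative of the cutoff function in `u`. -/
noncomputable def density (g f c g₁ f₁ c₁ a t u : ℝ) : ℝ :=
  quad g f c u / quad g₁ f₁ c₁ u *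
    (a + t * ((g * u + f) / quad g f c u - (g₁ * u + f₁) / (2 * quad g₁ f₁ c₁ u))) ^ 2 -
  g * t ^ 2 / quad g₁ f₁ c₁ u

theorem abs_quad_le {g f c e : ℝ} (hg : |g| ≤ e) (hf : |f| ≤ e) (hc : |c| ≤ e) (u : ℝ) :
    |quad g f c u| ≤ 2 * e * (1 + u ^ 2) := by
  have he : 0 ≤ e := (abs_nonneg g).trans hg
  have h1 : |g * (u ^ 2 / 2)| ≤ e * (u ^ 2 / 2) := by
    rw [abs_mul, abs_of_nonneg (by positivity : 0 ≤ u ^ 2 / 2)]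
    gcongr
  have h2 : |f * u| ≤ e * |u| := by
    rw [abs_mul]
    gcongr
  have h3 : |u| ≤ (1 + u ^ 2) / 2 := by nlinarith [sq_nonneg (|u| - 1), sq_abs u]
  have h4 := abs_add_three (g * (u ^ 2 / 2)) (f * u) c
  rw [quad]
  have h5 : e * |u| ≤ e * ((1 + u ^ 2) / 2) := by gcongr
  nlinarith [mul_nonneg he (sq_nonneg u)]

theorem sq_linear_le {g f e : ℝ} (hg : |g| ≤ e) (hf : |f| ≤ e) (u : ℝ) :
    (g * u + f) ^ 2 ≤ 2 * e ^ 2 * (1 + u ^ 2) := by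
  have h1 : g ^ 2 ≤ e ^ 2 := sq_le_sq' (abs_le.1 hg).1 (abs_le.1 hg).2
  have h2 : f ^ 2 ≤ e ^ 2 := sq_le_sq' (abs_le.1 hf).1 (abs_le.1 hf).2
  have h3 : (g * u + f) ^ 2 ≤ 2 * ((g * u) ^ 2 + f ^ 2) := by nlinarith [sq_nonneg (g * u - f)]
  have h4 : (g * u) ^ 2 ≤ e ^ 2 * u ^ 2 := by rw [mul_pow]; gcongr
  nlinarith

theorem sq_div_le {q Q m M Y : ℝ} (hm : 0 < m) (hY : 0 < Y) (hq : q ^ 2 ≤ 2 * M ^ 2 * Y)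
    (hQ : m * Y ≤ Q) : (q / Q) ^ 2 ≤ 2 * M ^ 2 / m ^ 2 / Y := by
  have h0 : 0 < m * Y := by positivity
  have h1 : (m * Y) ^ 2 ≤ Q ^ 2 := by gcongr
  calc (q / Q) ^ 2 = q ^ 2 / Q ^ 2 := div_pow _ _ _
    _ ≤ 2 * M ^ 2 * Y / (m * Y) ^ 2 := div_le_div₀ (by positivity) hq (by positivity) h1
    _ = 2 * M ^ 2 / m ^ 2 / Y := by field_simp

/-- Both quadratics are at least `m (1 + u²)` and the first is at most `2M (1 + u²)`, so their ratio
is bounded, while each logarithmic derivative is of order `(1 + u²)^{-1/2}`. The square of the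
three-term sum is bounded by 3 times the sum of squares. -/
theorem abs_density_le {g f c g₁ f₁ c₁ a t u m M B : ℝ} (hm : 0 < m)
    (hg : |g| ≤ M) (hf : |f| ≤ M) (hc : |c| ≤ M) (hg₁ : |g₁| ≤ M) (hf₁ : |f₁| ≤ M)
    (hQ : m * (1 + u ^ 2) ≤ quad g f c u) (hQ₁ : m * (1 + u ^ 2) ≤ quad g₁ f₁ c₁ u)
    (ha : a ^ 2 ≤ B / (1 + u ^ 2)) (ht : t ^ 2 ≤ 1) :
    |density g f c g₁ f₁ c₁ a t u| ≤
      (2 * M / m * (3 * (B + 2 * M ^ 2 / m ^ 2 + 2 * M ^ 2 / m ^ 2)) + M / m) *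
        (1 + u ^ 2)⁻¹ := by
  have hY : 0 < 1 + u ^ 2 := by positivity
  have hM : 0 ≤ M := (abs_nonneg g).trans hg
  have hQ0 : 0 < quad g f c u := lt_of_lt_of_le (by positivity) hQ
  have hQ10 : 0 < quad g₁ f₁ c₁ u := lt_of_lt_of_le (by positivity) hQ₁
  have hQu : quad g f c u ≤ 2 * M * (1 + u ^ 2) := (le_abs_self _).trans (abs_quad_le hg hf hc u)
  have b1 := sq_div_le hm hY (sq_linear_le hg hf u) hQ
  have b2 : ((g₁ * u + f₁) / (2 * quad g₁ f₁ c₁ u)) ^ 2 ≤ 2 * M ^ 2 / m ^ 2 / (1 + u ^ 2) :=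
    sq_div_le hm hY (sq_linear_le hg₁ hf₁ u) (by linarith)
  have r1 : quad g f c u / quad g₁ f₁ c₁ u ≤ 2 * M / m := by
    calc _ ≤ 2 * M * (1 + u ^ 2) / (m * (1 + u ^ 2)) :=
          div_le_div₀ (by positivity) hQu (by positivity) hQ₁
      _ = 2 * M / m := by field_simp
  have r0 : 0 ≤ quad g f c u / quad g₁ f₁ c₁ u := by positivity
  have s1 : (a + t * ((g * u + f) / quad g f c u - (g₁ * u + f₁) / (2 * quad g₁ f₁ c₁ u))) ^ 2 ≤
      3 * (B + 2 * M ^ 2 / m ^ 2 + 2 * M ^ 2 / m ^ 2) / (1 + u ^ 2) := by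
    set x := (g * u + f) / quad g f c u
    set y := (g₁ * u + f₁) / (2 * quad g₁ f₁ c₁ u)
    have e1 : (t * x) ^ 2 ≤ x ^ 2 := by
      rw [mul_pow]; exact mul_le_of_le_one_left (sq_nonneg _) ht
    have e2 : (t * y) ^ 2 ≤ y ^ 2 := by
      rw [mul_pow]; exact mul_le_of_le_one_left (sq_nonneg _) ht
    calc (a + t * (x - y)) ^ 2 ≤ 3 * (a ^ 2 + (t * x) ^ 2 + (t * y) ^ 2) := by
          nlinarith [sq_nonneg (a - t * x), sq_nonneg (a + t * y), sq_nonneg (t * x + t * y)]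
      _ ≤ 3 * (B / (1 + u ^ 2) + 2 * M ^ 2 / m ^ 2 / (1 + u ^ 2) +
          2 * M ^ 2 / m ^ 2 / (1 + u ^ 2)) := by gcongr <;> linarith
      _ = _ := by ring
  have s2 : |g * t ^ 2 / quad g₁ f₁ c₁ u| ≤ M / m / (1 + u ^ 2) := by
    rw [abs_div, abs_mul, abs_of_pos hQ10, abs_of_nonneg (sq_nonneg t), div_div]
    refine div_le_div₀ hM ?_ (by positivity) hQ₁
    calc |g| * t ^ 2 ≤ M * 1 := by gcongr
      _ = M := mul_one M
  calc |density g f c g₁ f₁ c₁ a t u| ≤ |quad g f c u / quad g₁ f₁ c₁ u *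
      (a + t * ((g * u + f) / quad g f c u - (g₁ * u + f₁) / (2 * quad g₁ f₁ c₁ u))) ^ 2| +
        |g * t ^ 2 / quad g₁ f₁ c₁ u| := abs_sub _ _
    _ ≤ 2 * M / m * (3 * (B + 2 * M ^ 2 / m ^ 2 + 2 * M ^ 2 / m ^ 2) / (1 + u ^ 2)) +
        M / m / (1 + u ^ 2) := by
      refine add_le_add ?_ s2
      rw [abs_of_nonneg (by positivity)]
      exact mul_le_mul r1 s1 (sq_nonneg _) (by positivity)
    _ = _ := by ring

/-- The density of the limit. -/
theorem density_self {g f c u : ℝ} (hQ : 0 < quad g f c u) :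
    density g f c g f c 0 1 u = ((g * u + f) / (2 * quad g f c u)) ^ 2 - g / quad g f c u := by
  rw [density]
  field_simp
  ring

theorem hasDerivAt_quad (g f c u : ℝ) : HasDerivAt (quad g f c) (g * u + f) u := by
  have := (((((hasDerivAt_id u).pow 2).div_const 2).const_mul g).add
    ((hasDerivAt_id u).const_mul f)).add_const c
  refine (this.congr_of_eventuallyEq ?_).congr_deriv ?_
  · exact Eventually.of_forall fun y => by simp [quad]
  · simp

/-- With `q = quad g f c` and `r² = 2cg - f²`, one has `q'² + r² = 2 g q`. Consequently `-q' / (4q)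
- (3g / 2r) arctan (q' / r)` is a primitive; its rational part vanishes at both ends and the
arctangent contributes `-(3π/2) g / r`, that is `(π/2 - 2π) g / r`. -/
theorem integral_density_self {g f c : ℝ} (hg : 0 < g) (h : f ^ 2 < 2 * c * g)
    (hi : Integrable fun u => density g f c g f c 0 1 u) :
    ∫ u, density g f c g f c 0 1 u =
      (Real.pi / 2 - 2 * Real.pi) * (g / √(2 * c * g - f ^ 2)) := by
  set r := √(2 * c * g - f ^ 2) with hr
  have hr0 : 0 < r := Real.sqrt_pos.2 (by linarith)
  have hr2 : r ^ 2 = 2 * c * g - f ^ 2 := Real.sq_sqrt (by linarith)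
  have hder : ∀ u, HasDerivAt (fun u => -((g * u + f) / (2 * (2 * quad g f c u))) * 1 +
      (-(3 * g / (2 * r))) * Real.arctan ((g * u + f) / r)) (density g f c g f c 0 1 u) u := by
    intro u
    have hQ := quad_pos hg h u
    have hl : HasDerivAt (fun u => g * u + f) g u := by
      simpa using ((hasDerivAt_id u).const_mul g).add_const f
    have hq := hasDerivAt_quad g f c u
    have h1 := (hl.div ((hq.const_mul 2).const_mul 2) (by positivity)).neg.mul_const 1
    have h2 := ((hl.div_const r).arctan).const_mul (-(3 * g / (2 * r)))
    refine (h1.add h2).congr_deriv ?_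
    have key : 1 + ((g * u + f) / r) ^ 2 = 2 * g * quad g f c u / r ^ 2 := by
      field_simp
      rw [hr2, quad]; ring
    rw [density_self hQ, key]
    have := hQ.ne'
    field_simp
    ring
  have t1 : ∀ l : Filter ℝ, Tendsto (fun u : ℝ => |u|) l atTop →
      Tendsto (fun u => -((g * u + f) / (2 * (2 * quad g f c u))) * 1) l (𝓝 0) := by
    intro l hl
    have hinv : Tendsto (fun u : ℝ => u⁻¹) l (𝓝 0) := by
      rw [tendsto_zero_iff_abs_tendsto_zero]
      exact (tendsto_inv_atTop_zero.comp hl).congr fun u => (abs_inv u).symm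
    -- The substitution `v = 1/u` treats both ends at once: the rational part becomes a function of
    -- `v` continuous at 0, its denominator there being `2g ≠ 0`.
    have hcont : ContinuousAt
        (fun v : ℝ => -((g * v + f * v ^ 2) / (4 * (g / 2 + f * v + c * v ^ 2)))) 0 := by
      refine ContinuousAt.neg (ContinuousAt.div (by fun_prop) (by fun_prop) ?_)
      simp [hg.ne']
    have hlim := hcont.tendsto.comp hinv
    have h0 : -((g * 0 + f * 0 ^ 2) / (4 * (g / 2 + f * 0 + c * 0 ^ 2))) = 0 := by simp
    rw [h0] at hlim
    refine hlim.congr' ?_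
    filter_upwards [hl.eventually_gt_atTop 0] with u hu
    have hu0 : u ≠ 0 := abs_pos.1 hu
    have hQ := (quad_pos hg h u).ne'
    have e1 : 4 * (g / 2 + f * u⁻¹ + c * u⁻¹ ^ 2) = 4 * quad g f c u / u ^ 2 := by
      rw [quad]; field_simp
    simp only [Function.comp_apply, e1]
    field_simp
    ring
  have t2 : Tendsto (fun u => (g * u + f) / r) atTop atTop :=
    (tendsto_atTop_add_const_right _ f (tendsto_id.const_mul_atTop hg)).atTop_div_const hr0
  have t3 : Tendsto (fun u => (g * u + f) / r) atBot atBot :=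
    (tendsto_atBot_add_const_right _ f (tendsto_id.const_mul_atBot hg)).atBot_div_const hr0
  have t4 := (t1 atTop tendsto_abs_atTop_atTop).add
    (((tendsto_nhds_of_tendsto_nhdsWithin Real.tendsto_arctan_atTop).comp t2).const_mul
      (-(3 * g / (2 * r))))
  have t5 := (t1 atBot tendsto_abs_atBot_atTop).add
    (((tendsto_nhds_of_tendsto_nhdsWithin Real.tendsto_arctan_atBot).comp t3).const_mul
      (-(3 * g / (2 * r))))
  rw [integral_of_hasDerivAt_of_tendsto hder hi t5 t4]
  field_simp
  ring

theorem exists_quad_bounds {K : Set ℝ} (hK : IsCompact K) {g f c : ℝ → ℝ} (cg : ContinuousOn g K)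
    (cf : ContinuousOn f K) (cc : ContinuousOn c K) (hg : ∀ s ∈ K, 0 < g s)
    (h : ∀ s ∈ K, f s ^ 2 < 2 * c s * g s) :
    ∃ m > 0, ∃ M, (∀ s ∈ K, |g s| ≤ M ∧ |f s| ≤ M ∧ |c s| ≤ M) ∧
      ∀ s ∈ K, ∀ u, m * (1 + u ^ 2) ≤ quad (g s) (f s) (c s) u := by
  obtain ⟨M₁, h1⟩ := hK.exists_bound_of_continuousOn cg
  obtain ⟨M₂, h2⟩ := hK.exists_bound_of_continuousOn cf
  obtain ⟨M₃, h3⟩ := hK.exists_bound_of_continuousOn cc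
  have hc : ∀ s ∈ K, 0 < g s + 2 * c s := fun s hs => by
    have h1 := quad_pos (hg s hs) (h s hs) 0
    have h2 := hg s hs
    simp only [quad] at h1
    nlinarith
  have cm : ContinuousOn (fun s => (2 * c s * g s - f s ^ 2) / (2 * (g s + 2 * c s))) K :=
    (((continuousOn_const.mul cc).mul cg).sub (cf.pow 2)).div
      (continuousOn_const.mul (cg.add (continuousOn_const.mul cc)))
      fun s hs => (mul_pos two_pos (hc s hs)).ne'
  obtain ⟨m, hm, hm'⟩ : ∃ m > 0, ∀ s ∈ K, m ≤ (2 * c s * g s - f s ^ 2) / (2 * (g s + 2 * c s)) := by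
    rcases K.eq_empty_or_nonempty with rfl | hne
    · exact ⟨1, one_pos, by simp⟩
    · obtain ⟨s, hs, hmin⟩ := hK.exists_isMinOn hne cm
      exact ⟨_, div_pos (by linarith [h s hs]) (mul_pos two_pos (hc s hs)), fun t ht => hmin ht⟩
  refine ⟨m, hm, max M₁ (max M₂ M₃), fun s hs => ⟨(h1 s hs).trans (le_max_left _ _),
    (h2 s hs).trans ((le_max_left _ _).trans (le_max_right _ _)),
    (h3 s hs).trans ((le_max_right _ _).trans (le_max_right _ _))⟩, fun s hs u => ?_⟩
  exact (mul_le_mul_of_nonneg_right (hm' s hs) (by positivity)).trans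
    (quad_lower (hg s hs) (h s hs) u)

/-! ### Passage to the limit under the integral -/

theorem quad_lower_of_close {g f c g₁ f₁ c₁ m u : ℝ} (hQ : m * (1 + u ^ 2) ≤ quad g f c u)
    (hg : |g₁ - g| ≤ m / 4) (hf : |f₁ - f| ≤ m / 4) (hc : |c₁ - c| ≤ m / 4) :
    m / 2 * (1 + u ^ 2) ≤ quad g₁ f₁ c₁ u := by
  -- Coefficient errors of `m/4` change the quadratic by at most `2 (m/4) (1 + u²)`, which leaves
  -- half of the lower bound.
  have h1 := (abs_le.1 (abs_quad_le hg hf hc u)).1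
  have h2 : quad (g₁ - g) (f₁ - f) (c₁ - c) u = quad g₁ f₁ c₁ u - quad g f c u := by
    simp only [quad]; ring
  linarith

/-- `f k` is eventually continuous on `K` and converges to `f₀` uniformly on `K`. -/
def UniformApprox (K : Set ℝ) (f : ℕ → ℝ → ℝ) (f₀ : ℝ → ℝ) : Prop :=
  (∀ᶠ k in atTop, ContinuousOn (f k) K) ∧ ∀ e > 0, ∀ᶠ k in atTop, ∀ s ∈ K, |f k s - f₀ s| ≤ e

theorem UniformApprox.tendsto {K : Set ℝ} {f : ℕ → ℝ → ℝ} {f₀ : ℝ → ℝ} (h : UniformApprox K f f₀)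
    {s : ℝ} (hs : s ∈ K) : Tendsto (fun k => f k s) atTop (𝓝 (f₀ s)) := by
  rw [Metric.tendsto_nhds]
  intro e he
  filter_upwards [h.2 (e / 2) (by linarith)] with k hk
  exact (hk s hs).trans_lt (by linarith)

theorem continuousOn_quad {K : Set ℝ} {g f c : ℝ → ℝ} (cg : ContinuousOn g K)
    (cf : ContinuousOn f K) (cc : ContinuousOn c K) :
    ContinuousOn (fun w : ℝ × ℝ => quad (g w.2) (f w.2) (c w.2) w.1) (univ ×ˢ K) := by
  have lift : ∀ {f : ℝ → ℝ}, ContinuousOn f K →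
      ContinuousOn (fun w : ℝ × ℝ => f w.2) (univ ×ˢ K) := fun hf =>
    hf.comp continuousOn_snd fun w hw => hw.2
  have h1 := lift cg
  have h2 := lift cf
  have h3 := lift cc
  unfold quad
  fun_prop

theorem continuousOn_density {K : Set ℝ} {g f c g₁ f₁ c₁ a t : ℝ → ℝ} (cg : ContinuousOn g K)
    (cf : ContinuousOn f K) (cc : ContinuousOn c K) (cg₁ : ContinuousOn g₁ K)
    (cf₁ : ContinuousOn f₁ K) (cc₁ : ContinuousOn c₁ K) (ca : Continuous a) (ct : Continuous t)
    (hQ : ∀ s ∈ K, ∀ u, quad (g s) (f s) (c s) u ≠ 0)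
    (hQ₁ : ∀ s ∈ K, ∀ u, quad (g₁ s) (f₁ s) (c₁ s) u ≠ 0) :
    ContinuousOn (fun w : ℝ × ℝ => density (g w.2) (f w.2) (c w.2) (g₁ w.2) (f₁ w.2) (c₁ w.2)
      (a w.1) (t w.1) w.1) (univ ×ˢ K) := by
  have lift : ∀ {f : ℝ → ℝ}, ContinuousOn f K →
      ContinuousOn (fun w : ℝ × ℝ => f w.2) (univ ×ˢ K) := fun hf =>
    hf.comp continuousOn_snd fun w hw => hw.2
  have q := continuousOn_quad cg cf cc
  have q₁ := continuousOn_quad cg₁ cf₁ cc₁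
  have h1 : ∀ w ∈ (univ : Set ℝ) ×ˢ K, quad (g w.2) (f w.2) (c w.2) w.1 ≠ 0 := fun w hw =>
    hQ _ hw.2 _
  have h2 : ∀ w ∈ (univ : Set ℝ) ×ˢ K, quad (g₁ w.2) (f₁ w.2) (c₁ w.2) w.1 ≠ 0 := fun w hw =>
    hQ₁ _ hw.2 _
  have ca' : ContinuousOn (fun w : ℝ × ℝ => a w.1) (univ ×ˢ K) := by fun_prop
  have ct' : ContinuousOn (fun w : ℝ × ℝ => t w.1) (univ ×ˢ K) := by fun_prop
  unfold density
  exact ((q.div q₁ h2).mul ((ca'.add (ct'.mul (((((lift cg).mul continuousOn_fst).add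
    (lift cf)).div q h1).sub ((((lift cg₁).mul continuousOn_fst).add (lift cf₁)).div
    (continuousOn_const.mul q₁) fun w hw => mul_ne_zero two_ne_zero (h2 w hw))))).pow 2)).sub
    (((lift cg).mul (ct'.pow 2)).div q₁ h2)

theorem tendsto_integral_density {K : Set ℝ} (hK : IsCompact K) {p g f c : ℝ → ℝ}
    {g₁ f₁ c₁ : ℕ → ℝ → ℝ} {a t : ℕ → ℝ → ℝ} {B : ℝ}
    (cp : ContinuousOn p K) (cg : ContinuousOn g K) (cf : ContinuousOn f K)
    (cc : ContinuousOn c K) (hg : ∀ s ∈ K, 0 < g s) (h : ∀ s ∈ K, f s ^ 2 < 2 * c s * g s)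
    (ag : UniformApprox K g₁ g) (af : UniformApprox K f₁ f) (ac : UniformApprox K c₁ c)
    (ca : ∀ k, Continuous (a k)) (ct : ∀ k, Continuous (t k))
    (ha : ∀ᶠ k in atTop, ∀ u, a k u ^ 2 ≤ B / (1 + u ^ 2)) (ht : ∀ k u, t k u ^ 2 ≤ 1)
    (ha' : ∀ u, Tendsto (fun k => a k u) atTop (𝓝 0))
    (ht' : ∀ u, Tendsto (fun k => t k u) atTop (𝓝 1)) :
    Tendsto (fun k => ∫ w in univ ×ˢ K, p w.2 * density (g w.2) (f w.2) (c w.2)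
      (g₁ k w.2) (f₁ k w.2) (c₁ k w.2) (a k w.1) (t k w.1) w.1) atTop
      (𝓝 ((Real.pi / 2 - 2 * Real.pi) *
        ∫ s in K, p s * (g s / √(2 * c s * g s - f s ^ 2)))) := by
  obtain ⟨m, hm, M, hM, hQ⟩ := exists_quad_bounds hK cg cf cc hg h
  obtain ⟨P, hP⟩ := hK.exists_bound_of_continuousOn cp
  have hY : ∀ u : ℝ, 0 < 1 + u ^ 2 := fun u => by positivity
  have hKm : MeasurableSet K := hK.isClosed.measurableSet
  have hm' : MeasurableSet ((univ : Set ℝ) ×ˢ K) := MeasurableSet.univ.prod hKm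
  have cp' : ContinuousOn (fun w : ℝ × ℝ => p w.2) (univ ×ˢ K) :=
    cp.comp continuousOn_snd fun w hw => hw.2
  -- `m₁` and `M₁` serve the exact coefficients and, for large `k`, the regularized ones. Taking `B₁
  -- ≥ 0` lets the same constant `C` cover the limit density, where `a = 0`.
  set m₁ := m / 2 with hm₁
  have hm₁0 : 0 < m₁ := by positivity
  set M₁ := M + m / 4 with hM₁
  set B₁ := max B 0 with hB₁
  set C := 2 * M₁ / m₁ * (3 * (B₁ + 2 * M₁ ^ 2 / m₁ ^ 2 + 2 * M₁ ^ 2 / m₁ ^ 2)) + M₁ / m₁ with hC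
  have hQ' : ∀ s ∈ K, ∀ u, m₁ * (1 + u ^ 2) ≤ quad (g s) (f s) (c s) u := fun s hs u =>
    le_trans (by have := hY u; simp only [hm₁]; nlinarith) (hQ s hs u)
  have hM' : ∀ s ∈ K, |g s| ≤ M₁ ∧ |f s| ≤ M₁ ∧ |c s| ≤ M₁ := fun s hs => by
    obtain ⟨h1, h2, h3⟩ := hM s hs
    refine ⟨?_, ?_, ?_⟩ <;> linarith
  have hQ0 : ∀ s ∈ K, ∀ u, quad (g s) (f s) (c s) u ≠ 0 := fun s hs u =>
    (quad_pos (hg s hs) (h s hs) u).ne'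
  have hbound : IntegrableOn (fun w : ℝ × ℝ => P * (C * (1 + w.1 ^ 2)⁻¹)) (univ ×ˢ K) := by
    rw [IntegrableOn, Measure.volume_eq_prod, ← Measure.prod_restrict, Measure.restrict_univ]
    have := ((integrable_inv_one_add_sq.const_mul C).const_mul P).mul_prod
      (integrableOn_const (C := (1 : ℝ)) hK.measure_lt_top.ne : IntegrableOn (fun _ => (1 : ℝ)) K)
    simpa using this
  have hlimbound : ∀ w ∈ (univ : Set ℝ) ×ˢ K, ‖p w.2 * density (g w.2) (f w.2) (c w.2)
      (g w.2) (f w.2) (c w.2) 0 1 w.1‖ ≤ P * (C * (1 + w.1 ^ 2)⁻¹) := by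
    intro w hw
    obtain ⟨h1, h2, h3⟩ := hM' _ hw.2
    rw [norm_mul]
    refine mul_le_mul (hP _ hw.2) (abs_density_le hm₁0 h1 h2 h3 h1 h2 (hQ' _ hw.2 _)
      (hQ' _ hw.2 _) ?_ (by norm_num)) (norm_nonneg _) ((norm_nonneg _).trans (hP _ hw.2))
    have := hY w.1
    have : 0 ≤ B₁ := le_max_right _ _
    simp only [ne_eq, OfNat.ofNat_ne_zero, not_false_eq_true, zero_pow]
    positivity
  have clim : ContinuousOn (fun w : ℝ × ℝ => p w.2 * density (g w.2) (f w.2) (c w.2)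
      (g w.2) (f w.2) (c w.2) 0 1 w.1) (univ ×ˢ K) :=
    cp'.mul (continuousOn_density cg cf cc cg cf cc (a := fun _ => 0) (t := fun _ => 1)
      continuous_const continuous_const hQ0 hQ0)
  have ilim : IntegrableOn (fun w : ℝ × ℝ => p w.2 * density (g w.2) (f w.2) (c w.2)
      (g w.2) (f w.2) (c w.2) 0 1 w.1) (univ ×ˢ K) :=
    hbound.mono' (clim.aestronglyMeasurable hm')
      ((ae_restrict_iff' hm').2 (Eventually.of_forall hlimbound))
  have hval : ∫ w in univ ×ˢ K, p w.2 * density (g w.2) (f w.2) (c w.2)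
      (g w.2) (f w.2) (c w.2) 0 1 w.1 = (Real.pi / 2 - 2 * Real.pi) *
        ∫ s in K, p s * (g s / √(2 * c s * g s - f s ^ 2)) := by
    rw [IntegrableOn, Measure.volume_eq_prod, ← Measure.prod_restrict,
      Measure.restrict_univ] at ilim
    rw [Measure.volume_eq_prod, ← Measure.prod_restrict, Measure.restrict_univ,
      integral_prod_symm _ ilim, ← integral_const_mul]
    refine setIntegral_congr_fun hKm fun s hs => ?_
    have hi : Integrable fun u => density (g s) (f s) (c s) (g s) (f s) (c s) 0 1 u := by
      obtain ⟨h1, h2, h3⟩ := hM' _ hs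
      refine (integrable_inv_one_add_sq.const_mul C).mono' ?_ (Eventually.of_forall fun u =>
        abs_density_le hm₁0 h1 h2 h3 h1 h2 (hQ' _ hs _) (hQ' _ hs _) ?_ (by norm_num))
      · have := continuousOn_density (K := {s}) (a := fun _ => 0) (t := fun _ => 1)
          (cg.mono (singleton_subset_iff.2 hs)) (cf.mono (singleton_subset_iff.2 hs))
          (cc.mono (singleton_subset_iff.2 hs)) (cg.mono (singleton_subset_iff.2 hs))
          (cf.mono (singleton_subset_iff.2 hs)) (cc.mono (singleton_subset_iff.2 hs))
          continuous_const continuous_const (fun r hr => hQ0 r (hr ▸ hs))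
          (fun r hr => hQ0 r (hr ▸ hs))
        exact (this.comp_continuous (f := fun u => (u, s)) (by fun_prop)
          fun u => ⟨mem_univ _, rfl⟩).aestronglyMeasurable
      · have := hY u
        have : 0 ≤ B₁ := le_max_right _ _
        simp only [ne_eq, OfNat.ofNat_ne_zero, not_false_eq_true, zero_pow]
        positivity
    simp only
    rw [integral_const_mul, integral_density_self (hg s hs) (h s hs) hi]
    ring
  rw [← hval]
  have m4 : 0 < m / 4 := by positivity
  have hclose : ∀ᶠ k in atTop, ∀ s ∈ K, (|g₁ k s| ≤ M₁ ∧ |f₁ k s| ≤ M₁) ∧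
      ∀ u, m₁ * (1 + u ^ 2) ≤ quad (g₁ k s) (f₁ k s) (c₁ k s) u := by
    filter_upwards [ag.2 _ m4, af.2 _ m4, ac.2 _ m4] with k h1 h2 h3 s hs
    obtain ⟨h4, h5, -⟩ := hM s hs
    refine ⟨⟨?_, ?_⟩, fun u => quad_lower_of_close (hQ s hs u) (h1 s hs) (h2 s hs) (h3 s hs)⟩
    · linarith [h1 s hs, abs_sub_abs_le_abs_sub (g₁ k s) (g s)]
    · linarith [h2 s hs, abs_sub_abs_le_abs_sub (f₁ k s) (f s)]
  refine tendsto_integral_filter_of_dominated_convergence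
    (fun w => P * (C * (1 + w.1 ^ 2)⁻¹)) ?_ ?_ hbound ?_
  · filter_upwards [hclose, ag.1, af.1, ac.1] with k hk h1 h2 h3
    refine (cp'.mul (continuousOn_density cg cf cc h1 h2 h3 (ca k) (ct k) hQ0
      fun s hs u => ?_)).aestronglyMeasurable hm'
    exact (lt_of_lt_of_le (mul_pos hm₁0 (hY u)) ((hk s hs).2 u)).ne'
  · filter_upwards [hclose, ha] with k hk hak
    refine (ae_restrict_iff' hm').2 (Eventually.of_forall fun w hw => ?_)
    obtain ⟨h1, h2, h3⟩ := hM' _ hw.2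
    obtain ⟨⟨h4, h5⟩, h6⟩ := hk _ hw.2
    rw [norm_mul]
    refine mul_le_mul (hP _ hw.2) (abs_density_le hm₁0 h1 h2 h3 h4 h5 (hQ' _ hw.2 _)
      (h6 _) ((hak _).trans ?_) (ht _ _)) (norm_nonneg _) ((norm_nonneg _).trans (hP _ hw.2))
    exact div_le_div_of_nonneg_right (le_max_left _ _) (hY _).le
  · refine (ae_restrict_iff' hm').2 (Eventually.of_forall fun w hw => ?_)
    have lg := ag.tendsto hw.2
    have lf := af.tendsto hw.2
    have lc := ac.tendsto hw.2
    have lq : Tendsto (fun k => quad (g₁ k w.2) (f₁ k w.2) (c₁ k w.2) w.1) atTop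
        (𝓝 (quad (g w.2) (f w.2) (c w.2) w.1)) :=
      ((lg.mul_const _).add (lf.mul_const _)).add lc
    have h0 := hQ0 _ hw.2 w.1
    refine Tendsto.const_mul _ ?_
    exact (((tendsto_const_nhds (x := quad (g w.2) (f w.2) (c w.2) w.1)).div lq h0).mul
      (((ha' w.1).add ((ht' w.1).mul (tendsto_const_nhds.sub
      (((lg.mul_const _).add lf).div (lq.const_mul 2) (mul_ne_zero two_ne_zero h0))))).pow 2)).sub
      ((((ht' w.1).pow 2).const_mul _).div lq h0)

/-! ### Cutoff functions -/

namespace Heisenberg.IsCutoff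

variable {δ : ℝ} {χ : ℝ → ℝ} (hχ : IsCutoff δ χ)
include hχ

theorem hasCompactSupport : HasCompactSupport χ := by
  refine HasCompactSupport.intro (isCompact_closedBall (0 : ℝ) (2 * δ)) fun t ht => hχ.eq_zero t ?_
  rw [mem_closedBall_zero_iff, not_le] at ht
  exact ht.le

theorem continuous_deriv : Continuous (deriv χ) :=
  hχ.smooth.continuous_deriv (by exact_mod_cast le_top)

theorem hasDerivAt (t : ℝ) : HasDerivAt χ (deriv χ t) t :=
  (hχ.smooth.differentiable (by simp) t).hasDerivAt

theorem exists_deriv_bound : ∃ B, 0 ≤ B ∧ ∀ t, deriv χ t ^ 2 * (1 + t ^ 2) ≤ B := by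
  have hc : HasCompactSupport fun t => deriv χ t * (deriv χ t * (1 + t ^ 2)) :=
    hχ.hasCompactSupport.deriv.mul_right
  have := hχ.continuous_deriv
  obtain ⟨B, hB⟩ := hc.exists_bound_of_continuous (by fun_prop)
  refine ⟨B, (norm_nonneg _).trans (hB 0), fun t => ?_⟩
  have := (le_abs_self _).trans (hB t)
  linarith

theorem sq_le_one (t : ℝ) : χ t ^ 2 ≤ 1 := pow_le_one₀ (hχ.nonneg t) (hχ.le_one t)

/-- For `k ≥ 1`, `1 + u² ≤ k² + u² = k² (1 + (u/k)²)`, and the factor `k²` is absorbed by the factor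
`1/k` in the derivative; what remains is the unscaled bound at `u/k`. The resulting majorant is
independent of `k` and integrable in `u`. -/
theorem exists_scaled_deriv_bound :
    ∃ B, ∀ᶠ k : ℕ in atTop, ∀ u : ℝ, (deriv χ (u / k) / k) ^ 2 ≤ B / (1 + u ^ 2) := by
  obtain ⟨B, hB0, hB⟩ := hχ.exists_deriv_bound
  refine ⟨B, ?_⟩
  filter_upwards [eventually_ge_atTop 1] with k hk u
  have hk' : (1 : ℝ) ≤ k := by exact_mod_cast hk
  have h0 : (0 : ℝ) < k := by linarith
  have h1 := hB (u / k)
  rw [le_div_iff₀ (by positivity)]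
  calc (deriv χ (u / k) / k) ^ 2 * (1 + u ^ 2)
      ≤ (deriv χ (u / k) / k) ^ 2 * ((k : ℝ) ^ 2 + u ^ 2) := by
        gcongr
        nlinarith
    _ = deriv χ (u / k) ^ 2 * (1 + (u / k) ^ 2) := by field_simp
    _ ≤ B := h1

theorem tendsto_scaled (hδ : 0 < δ) (u : ℝ) :
    Tendsto (fun k : ℕ => χ (u / k)) atTop (𝓝 1) := by
  have h := (hχ.smooth.continuous.tendsto 0).comp (tendsto_const_div_atTop_nhds_zero_nat u)
  rwa [hχ.eq_one 0 (by simpa using hδ.le)] at h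

theorem tendsto_scaled_deriv (u : ℝ) :
    Tendsto (fun k : ℕ => deriv χ (u / k) / k) atTop (𝓝 0) := by
  have h := (hχ.continuous_deriv.tendsto 0).comp (tendsto_const_div_atTop_nhds_zero_nat u)
  have h2 := h.mul (tendsto_inv_atTop_nhds_zero_nat (𝕜 := ℝ))
  rw [mul_zero] at h2
  exact h2.congr fun k => (div_eq_mul_inv _ _).symm

theorem deriv_eq_zero {t : ℝ} (ht : 2 * δ < |t|) : deriv χ t = 0 := by
  have : χ =ᶠ[𝓝 t] fun _ => 0 := by
    filter_upwards [continuous_abs.continuousAt.eventually_const_lt ht] with r hr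
    exact hχ.eq_zero r hr.le
  rw [this.deriv_eq, deriv_const]

end Heisenberg.IsCutoff

theorem exists_isCutoff {δ : ℝ} (hδ : 0 < δ) : ∃ χ, IsCutoff δ χ := by
  let φ : ContDiffBump (0 : ℝ) := ⟨δ, 2 * δ, hδ, by linarith⟩
  refine ⟨φ, φ.contDiff, fun s => φ.nonneg, fun s => φ.le_one, fun s hs => ?_, fun s hs => ?_⟩
  · exact φ.one_of_mem_closedBall (by rw [mem_closedBall_zero_iff]; exact hs)
  · exact φ.zero_of_le_dist (by rw [Real.dist_eq, sub_zero]; exact hs)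

theorem exists_isMollifier : ∃ ζ, IsMollifier ζ := by
  let φ : ContDiffBump (0 : ℝ) := ⟨1 / 2, 1, by norm_num, by norm_num⟩
  refine ⟨φ.normed volume, φ.contDiff_normed, fun s => φ.nonneg_normed s, ?_, φ.integral_normed⟩
  rw [φ.tsupport_normed_eq, Real.closedBall_eq_Icc]
  simp [φ]

/-! ### The test functions -/

/-- The left side is the numerator from `secondVariation_eq` for `H = x t / r`, with `x = χ(s)`, `t
= χ(u/k)` and `r = √Q_k`; its first quotient is `H_u`. -/
theorem density_identity {g f c g₁ f₁ c₁ a t u x r : ℝ} (hr : 0 < r)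
    (hr2 : r ^ 2 = quad g₁ f₁ c₁ u) (hQ : 0 < quad g f c u) :
    ((x * a * r - x * t * ((g₁ * u + f₁) / (2 * r))) / r ^ 2 +
        x * t / r * (f + u * g) / quad g f c u) ^ 2 * quad g f c u - g * (x * t / r) ^ 2 =
      x ^ 2 * density g f c g₁ f₁ c₁ a t u := by
  rw [density, ← hr2]
  field_simp
  ring

theorem testPlane_eq (χ ζ F G σ : ℝ → ℝ) (k : ℕ) (w : ℝ × ℝ) :
    testPlane χ ζ F G σ k w = χ w.2 * χ (w.1 / k) / √(quad (deriv (mollify ζ k G) w.2)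
      (deriv (mollify ζ k F) w.2) (deriv (mollify ζ k σ) w.2) w.1) := rfl

theorem hasDerivAt_testPlane {δ : ℝ} {χ : ℝ → ℝ} (hχ : IsCutoff δ χ) (ζ F G σ : ℝ → ℝ) (k : ℕ)
    {u s : ℝ} (hQ : 0 < quad (deriv (mollify ζ k G) s) (deriv (mollify ζ k F) s)
      (deriv (mollify ζ k σ) s) u) :
    HasDerivAt (fun u => testPlane χ ζ F G σ k (u, s))
      ((χ s * (deriv χ (u / k) / k) * √(quad (deriv (mollify ζ k G) s) (deriv (mollify ζ k F) s)
          (deriv (mollify ζ k σ) s) u) -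
        χ s * χ (u / k) * ((deriv (mollify ζ k G) s * u + deriv (mollify ζ k F) s) /
          (2 * √(quad (deriv (mollify ζ k G) s) (deriv (mollify ζ k F) s)
          (deriv (mollify ζ k σ) s) u)))) /
        √(quad (deriv (mollify ζ k G) s) (deriv (mollify ζ k F) s)
          (deriv (mollify ζ k σ) s) u) ^ 2) u := by
  have h1 : HasDerivAt (fun u : ℝ => χ (u / k)) (deriv χ (u / k) / k) u := by
    have := (hχ.hasDerivAt (u / k)).comp u ((hasDerivAt_id u).div_const (k : ℝ))
    refine this.congr_deriv ?_
    rw [mul_one_div]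
  have h2 := (hasDerivAt_quad (deriv (mollify ζ k G) s) (deriv (mollify ζ k F) s)
    (deriv (mollify ζ k σ) s) u).sqrt hQ.ne'
  exact (h1.const_mul (χ s)).div h2 (Real.sqrt_pos.2 hQ).ne'

/-- Positivity and smoothness of `Q_k` are available only for `|s| < b`. Elsewhere `χ(s)` vanishes
on a neighbourhood, since `2δ < b`, so the quotient is locally zero whatever its denominator. -/
theorem contDiff_testPlane {δ : ℝ} {χ : ℝ → ℝ} (hχ : IsCutoff δ χ) {ζ F G σ : ℝ → ℝ} {k : ℕ}
    {b : ℝ} (hb : 2 * δ < b) (hG : ContDiffOn ℝ 2 (deriv (mollify ζ k G)) (Ioo (-b) b))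
    (hF : ContDiffOn ℝ 2 (deriv (mollify ζ k F)) (Ioo (-b) b))
    (hσ : ContDiffOn ℝ 2 (deriv (mollify ζ k σ)) (Ioo (-b) b))
    (hQ : ∀ s ∈ Ioo (-b) b, ∀ u, 0 < quad (deriv (mollify ζ k G) s) (deriv (mollify ζ k F) s)
      (deriv (mollify ζ k σ) s) u) : ContDiff ℝ 2 (testPlane χ ζ F G σ k) := by
  rw [contDiff_iff_contDiffAt]
  intro w
  by_cases hw : w.2 ∈ Ioo (-b) b
  · have key : ∀ {f : ℝ → ℝ}, ContDiffOn ℝ 2 f (Ioo (-b) b) →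
        ContDiffAt ℝ 2 (fun w : ℝ × ℝ => f w.2) w := fun hf =>
      (hf.contDiffAt (isOpen_Ioo.mem_nhds hw)).comp w contDiffAt_snd
    have hχ2 : ContDiff ℝ 2 χ := by exact_mod_cast contDiff_infty.1 hχ.smooth 2
    have h1 : ContDiffAt ℝ 2 (fun w : ℝ × ℝ => w.1) w := contDiffAt_fst
    have hq : ContDiffAt ℝ 2 (fun w : ℝ × ℝ => quad (deriv (mollify ζ k G) w.2)
        (deriv (mollify ζ k F) w.2) (deriv (mollify ζ k σ) w.2) w.1) w :=
      (((key hG).mul ((h1.pow 2).div_const 2)).add ((key hF).mul h1)).add (key hσ)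
    have hpos := hQ _ hw w.1
    exact ((hχ2.contDiffAt.comp w contDiffAt_snd).mul
      (hχ2.contDiffAt.comp w (h1.div_const (k : ℝ)))).div (hq.sqrt hpos.ne')
      (Real.sqrt_pos.2 hpos).ne'
  · have hw' : 2 * δ < |w.2| := by
      refine hb.trans_le ?_
      by_contra h
      exact hw (abs_lt.1 (not_le.1 h))
    refine (contDiffAt_const (c := (0 : ℝ))).congr_of_eventuallyEq ?_
    have hcont : ContinuousAt (fun w : ℝ × ℝ => |w.2|) w := by fun_prop
    filter_upwards [hcont.eventually_const_lt hw'] with y hy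
    rw [testPlane, hχ.eq_zero _ hy.le, zero_mul, zero_div]

theorem Heisenberg.IsMollifier.uniformApprox {ζ : ℝ → ℝ} (hζ : IsMollifier ζ) {f : ℝ → ℝ}
    {A b b' : ℝ} (hf : ContDiffOn ℝ 2 f (Ioo (-A) A)) (hb : 0 < b) (hbA : b < A) (hb' : b' < b) :
    UniformApprox (Icc (-b') b') (fun k => deriv (mollify ζ k f)) (deriv f) := by
  have hsub : Icc (-b') b' ⊆ Ioo (-b) b := fun s hs => ⟨by linarith [hs.1], by linarith [hs.2]⟩
  obtain ⟨h1, h2⟩ := hζ.mollify_spec hf hb hbA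
  exact ⟨h1.mono fun k hk => hk.continuousOn.mono hsub,
    fun e he => (h2 e he).mono fun k hk s hs => hk s (hsub hs)⟩

theorem sqrt_pow_three (x : ℝ) : √(1 + x ^ 2) ^ 3 = (1 + x ^ 2) ^ (3 / 2 : ℝ) := by
  rw [Real.sqrt_eq_rpow, ← Real.rpow_natCast, ← Real.rpow_mul (by positivity)]
  norm_num

/-! ### Second variation of the test functions and its limit -/

namespace Heisenberg.IsStrictStrip

variable {ε : ℝ} {F G σ : ℝ → ℝ} {S : Set H1}

theorem limitIntegral_eq {δ : ℝ} {χ : ℝ → ℝ} (hδε : δ < 2 * ε) (hχ : IsCutoff δ χ) :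
    limitIntegral ε χ F G σ =
    ∫ s in Icc (-(2 * δ)) (2 * δ), χ s ^ 2 / √(1 + G s ^ 2) ^ 3 *
      (deriv G s / √(2 * deriv σ s * deriv G s - deriv F s ^ 2)) := by
  have hJ : Icc (-(2 * δ)) (2 * δ) ⊆ stripJ ε := fun s hs =>
    ⟨by linarith [hs.1], by linarith [hs.2]⟩
  rw [limitIntegral]
  refine (setIntegral_eq_of_subset_of_forall_sdiff_eq_zero (isOpen_stripJ ε).measurableSet
    hJ fun s hs => ?_).trans ?_
  · rw [hχ.eq_zero s (by
      by_contra h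
      exact hs.2 (abs_le.1 (not_le.1 h).le))]
    simp
  · simp only [sqrt_pow_three]

theorem continuousOn_limit_integrand (hS : IsStrictStrip ε F G σ S) {χ : ℝ → ℝ}
    (cχ : Continuous χ) :
    ContinuousOn (fun s => χ s ^ 2 / √(1 + G s ^ 2) ^ 3 *
      (deriv G s / √(2 * deriv σ s * deriv G s - deriv F s ^ 2))) (stripJ ε) := by
  have c1 := hS.contDiffOn_G.continuousOn_deriv_stripJ
  have c2 := hS.contDiffOn_F.continuousOn_deriv_stripJ
  have c3 := hS.contDiffOn_σ.continuousOn_deriv_stripJ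
  have c4 := hS.contDiffOn_G.continuousOn
  have c5 := cχ.continuousOn (s := stripJ ε)
  refine ((c5.pow 2).div ((continuousOn_const.add (c4.pow 2)).sqrt.pow 3) fun s _ => ?_).mul
    (c1.div (((continuousOn_const.mul c3).mul c1).sub (c2.pow 2)).sqrt fun s hs => ?_)
  · exact pow_ne_zero 3 (Real.sqrt_pos.2 (by positivity : 0 < 1 + G s ^ 2)).ne'
  · exact (Real.sqrt_pos.2 (by linarith [hS.strict s hs])).ne'

section Test

variable (hS : IsStrictStrip ε F G σ S) (hG : ∀ s ∈ stripJ ε, 0 < deriv G s) {δ : ℝ}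
  {χ ζ : ℝ → ℝ} (hδ : 0 < δ) (hδε : δ < 2 * ε) (hχ : IsCutoff δ χ)
include hS hG hδ hδε hχ

theorem secondVariation_testSurface (hζ : IsMollifier ζ) : ∀ᶠ k : ℕ in atTop,
    C20 S (testSurface ε χ ζ F G σ k) ∧
    ContDiff ℝ 2 (perimeterVariation S (fieldX1 (testSurface ε χ ζ F G σ k))) ∧
    secondVariation S (fieldX1 (testSurface ε χ ζ F G σ k)) =
      ∫ w in univ ×ˢ Icc (-(2 * δ)) (2 * δ), χ w.2 ^ 2 / √(1 + G w.2 ^ 2) ^ 3 *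
        density (deriv G w.2) (deriv F w.2) (deriv σ w.2) (deriv (mollify ζ k G) w.2)
          (deriv (mollify ζ k F) w.2) (deriv (mollify ζ k σ) w.2)
          (deriv χ (w.1 / k) / k) (χ (w.1 / k)) w.1 := by
  -- The midpoint of `2δ` and `4ε`: it leaves room outside the support of `χ` and room for
  -- mollifying inside `J`.
  set b := δ + 2 * ε with hb
  have hε := hS.eps_pos
  have hb0 : 0 < b := by positivity
  have hbε : b < 4 * ε := by linarith
  have hbδ : 2 * δ < b := by linarith
  have hbJ : Icc (-b) b ⊆ stripJ ε := fun s hs => ⟨by linarith [hs.1], by linarith [hs.2]⟩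
  have hIb : Icc (-(2 * δ)) (2 * δ) ⊆ Ioo (-b) b := fun s hs =>
    ⟨by linarith [hs.1], by linarith [hs.2]⟩
  obtain ⟨m, hm, M, -, hQ⟩ := exists_quad_bounds (isCompact_Icc (a := -b) (b := b))
    (hS.contDiffOn_G.continuousOn_deriv_stripJ.mono hbJ)
    (hS.contDiffOn_F.continuousOn_deriv_stripJ.mono hbJ)
    (hS.contDiffOn_σ.continuousOn_deriv_stripJ.mono hbJ) (fun s hs => hG s (hbJ hs))
    (fun s hs => hS.strict s (hbJ hs))
  obtain ⟨g1, g2⟩ := hζ.mollify_spec hS.contDiffOn_G hb0 hbε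
  obtain ⟨f1, f2⟩ := hζ.mollify_spec hS.contDiffOn_F hb0 hbε
  obtain ⟨c1, c2⟩ := hζ.mollify_spec hS.contDiffOn_σ hb0 hbε
  have m4 : 0 < m / 4 := by positivity
  filter_upwards [eventually_gt_atTop 0, g1, f1, c1, g2 _ m4, f2 _ m4, c2 _ m4] with
    k hk g1 f1 c1 g2 f2 c2
  have hk' : (0 : ℝ) < k := by exact_mod_cast hk
  have hQk : ∀ s ∈ Ioo (-b) b, ∀ u, 0 < quad (deriv (mollify ζ k G) s) (deriv (mollify ζ k F) s)
      (deriv (mollify ζ k σ) s) u := fun s hs u =>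
    lt_of_lt_of_le (by positivity) (quad_lower_of_close (hQ s (Ioo_subset_Icc_self hs) u)
      (g2 s hs) (f2 s hs) (c2 s hs))
  have hH := contDiff_testPlane hχ hbδ g1 f1 c1 hQk
  have hcut : ∀ u : ℝ, 2 * δ * k < |u| → 2 * δ < |u / k| := fun u hu => by
    rw [abs_div, abs_of_pos hk', lt_div_iff₀ hk']
    exact hu
  obtain ⟨r1, r2, r3⟩ := hS.secondVariation_eq hG hH.contDiffOn (a := 2 * δ * k) (b := 2 * δ)
    (by positivity) (by linarith)
    (fun w hw => by rw [testPlane, hχ.eq_zero _ hw, zero_mul, zero_div])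
    (fun w hw => by
      have : 2 * δ ≤ |w.1 / k| := by
        rw [abs_div, abs_of_pos hk', le_div_iff₀ hk']
        exact hw
      rw [testPlane, hχ.eq_zero _ this, mul_zero, zero_div])
  refine ⟨r1, r2, r3.trans ?_⟩
  have hRm : MeasurableSet (Icc (-(2 * δ * k)) (2 * δ * k) ×ˢ Icc (-(2 * δ)) (2 * δ)) :=
    measurableSet_Icc.prod measurableSet_Icc
  refine (setIntegral_congr_fun hRm fun w hw => ?_).trans
    (setIntegral_eq_of_subset_of_forall_sdiff_eq_zero (MeasurableSet.univ.prod measurableSet_Icc)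
      (prod_mono (subset_univ _) subset_rfl) fun w hw => ?_).symm
  · obtain ⟨u, s⟩ := w
    have hs := hIb hw.2
    have hq := hQk s hs u
    have hd := hasDerivAt_testPlane hχ ζ F G σ k hq
    have hd2 : HasDerivAt (fun u => testPlane χ ζ F G σ k (u, s))
        (fderiv ℝ (testPlane χ ζ F G σ k) (u, s) (1, 0)) u :=
      (hH.differentiable two_ne_zero (u, s)).hasFDerivAt.comp_hasDerivAt (f := fun u => (u, s)) u
        ((hasDerivAt_id u).prodMk (hasDerivAt_const u s))
    have hQ0 : 0 < quad (deriv G s) (deriv F s) (deriv σ s) u :=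
      hS.stripQ_pos hG (w := (u, s)) (hbJ (Ioo_subset_Icc_self hs))
    simp only
    rw [hd2.unique hd, testPlane_eq, stripQ, density_identity (Real.sqrt_pos.2 hq)
      (Real.sq_sqrt hq.le) hQ0]
    ring
  · obtain ⟨u, s⟩ := w
    -- Off the box `|u|/k` exceeds `2δ` strictly, so both the cutoff and its derivative vanish
    -- there.
    have hu : 2 * δ * k < |u| := by
      by_contra h
      exact hw.2 ⟨abs_le.1 (not_lt.1 h), hw.1.2⟩
    simp only
    rw [density, hχ.deriv_eq_zero (hcut u hu), hχ.eq_zero _ (hcut u hu).le]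
    simp

theorem limitIntegral_pos : 0 < limitIntegral ε χ F G σ := by
  rw [limitIntegral_eq hδε hχ]
  have hJ : Icc (-(2 * δ)) (2 * δ) ⊆ stripJ ε := fun s hs =>
    ⟨by linarith [hs.1], by linarith [hs.2]⟩
  have hsq : ∀ s, 0 < √(1 + G s ^ 2) ^ 3 := fun s =>
    pow_pos (Real.sqrt_pos.2 (by positivity)) 3
  have hfac : ∀ s ∈ stripJ ε, 0 < deriv G s / √(2 * deriv σ s * deriv G s - deriv F s ^ 2) :=
    fun s hs => div_pos (hG s hs) (Real.sqrt_pos.2 (by linarith [hS.strict s hs]))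
  rw [setIntegral_pos_iff_support_of_nonneg_ae]
  · refine lt_of_lt_of_le ?_ (measure_mono (s := Icc (-δ) δ) fun s hs => ?_)
    · rw [Real.volume_Icc]
      simpa using hδ
    · have hs2 : s ∈ Icc (-(2 * δ)) (2 * δ) := ⟨by linarith [hs.1], by linarith [hs.2]⟩
      refine ⟨?_, hs2⟩
      rw [Function.mem_support, hχ.eq_one s (abs_le.2 hs)]
      have h1 := hsq s
      have h2 := hfac s (hJ hs2)
      positivity
  · refine (ae_restrict_iff' measurableSet_Icc).2 (Eventually.of_forall fun s hs => ?_)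
    exact mul_nonneg (div_nonneg (sq_nonneg _) (hsq s).le) (hfac s (hJ hs)).le
  · exact ((hS.continuousOn_limit_integrand hχ.smooth.continuous).mono hJ).integrableOn_compact
      isCompact_Icc

theorem tendsto_secondVariation_testSurface (hζ : IsMollifier ζ) :
    Tendsto (fun k : ℕ => secondVariation S (fieldX1 (testSurface ε χ ζ F G σ k))) atTop
      (𝓝 ((Real.pi / 2 - 2 * Real.pi) * limitIntegral ε χ F G σ)) := by
  have hε := hS.eps_pos
  have hJ : Icc (-(2 * δ)) (2 * δ) ⊆ stripJ ε := fun s hs =>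
    ⟨by linarith [hs.1], by linarith [hs.2]⟩
  have hb0 : 0 < δ + 2 * ε := by positivity
  have hbε : δ + 2 * ε < 4 * ε := by linarith
  have hbδ : 2 * δ < δ + 2 * ε := by linarith
  obtain ⟨B, hB⟩ := hχ.exists_scaled_deriv_bound
  rw [limitIntegral_eq hδε hχ]
  have cχ := hχ.smooth.continuous
  have cχ' := hχ.continuous_deriv
  refine (tendsto_integral_density (isCompact_Icc (a := -(2 * δ)) (b := 2 * δ))
    (p := fun s => χ s ^ 2 / √(1 + G s ^ 2) ^ 3)
    ((cχ.continuousOn.pow 2).div ((continuousOn_const.add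
      ((hS.contDiffOn_G.continuousOn.mono hJ).pow 2)).sqrt.pow 3) fun s _ =>
        pow_ne_zero 3 (Real.sqrt_pos.2 (by positivity : 0 < 1 + G s ^ 2)).ne')
    (hS.contDiffOn_G.continuousOn_deriv_stripJ.mono hJ)
    (hS.contDiffOn_F.continuousOn_deriv_stripJ.mono hJ)
    (hS.contDiffOn_σ.continuousOn_deriv_stripJ.mono hJ) (fun s hs => hG s (hJ hs))
    (fun s hs => hS.strict s (hJ hs))
    (hζ.uniformApprox hS.contDiffOn_G hb0 hbε hbδ) (hζ.uniformApprox hS.contDiffOn_F hb0 hbε hbδ)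
    (hζ.uniformApprox hS.contDiffOn_σ hb0 hbε hbδ)
    (a := fun k u => deriv χ (u / k) / k) (t := fun k u => χ (u / k))
    (fun k => by fun_prop) (fun k => by fun_prop) hB (fun k u => hχ.sq_le_one _)
    hχ.tendsto_scaled_deriv (hχ.tendsto_scaled hδ)).congr' ?_
  filter_upwards [hS.secondVariation_testSurface hG hδ hδε hχ hζ] with k hk
  exact hk.2.2.symm

end Test

/-! ### Instability, and reduction to `G' > 0` -/

theorem exists_secondVariation_neg_of_pos (hS : IsStrictStrip ε F G σ S)
    (hG : ∀ s ∈ stripJ ε, 0 < deriv G s) : ∃ ψ : H1 → ℝ, C20 S ψ ∧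
      ContDiffAt ℝ 2 (perimeterVariation S (fieldX1 ψ)) 0 ∧ secondVariation S (fieldX1 ψ) < 0 := by
  have hε := hS.eps_pos
  have hε2 : ε < 2 * ε := by linarith
  obtain ⟨χ, hχ⟩ := exists_isCutoff hε
  obtain ⟨ζ, hζ⟩ := exists_isMollifier
  have hneg : (Real.pi / 2 - 2 * Real.pi) * limitIntegral ε χ F G σ < 0 :=
    mul_neg_of_neg_of_pos (by linarith [Real.pi_pos]) (hS.limitIntegral_pos hG hε hε2 hχ)
  obtain ⟨k, ⟨h1, h2, -⟩, h3⟩ := ((hS.secondVariation_testSurface hG hε hε2 hχ hζ).and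
    ((hS.tendsto_secondVariation_testSurface hG hε hε2 hχ hζ).eventually_lt_const hneg)).exists
  exact ⟨_, h1, h2.contDiffAt, h3⟩

/-- A strip is also a strip with respect to the reversed parameter. -/
theorem reflect (hS : IsStrictStrip ε F G σ S) :
    IsStrictStrip ε (fun s => F (-s)) (fun s => G (-s)) (fun s => σ (-s)) S := by
  have hneg : ∀ {s : ℝ}, s ∈ stripJ ε → -s ∈ stripJ ε := fun hs =>
    ⟨by linarith [hs.2], by linarith [hs.1]⟩
  have hc : ∀ {f : ℝ → ℝ}, ContDiffOn ℝ 2 f (stripJ ε) →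
      ContDiffOn ℝ 2 (fun s => f (-s)) (stripJ ε) := fun hf =>
    hf.comp contDiff_neg.contDiffOn fun s hs => hneg hs
  have hPsi : ∀ w, Psi (fun s => F (-s)) (fun s => G (-s)) (fun s => σ (-s)) w =
      Psi F G σ (w.1, -w.2) := fun w => rfl
  have hinj : InjOn (Psi (fun s => F (-s)) (fun s => G (-s)) (fun s => σ (-s)))
      (univ ×ˢ stripJ ε) := by
    intro w hw w' hw' h
    rw [hPsi, hPsi] at h
    have := hS.injOn ⟨mem_univ _, hneg hw.2⟩ ⟨mem_univ _, hneg hw'.2⟩ h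
    simp only [Prod.mk.injEq, neg_inj] at this
    exact Prod.ext this.1 this.2
  have hdom : stripDomain ε (fun s => F (-s)) (fun s => G (-s)) (fun s => σ (-s)) =
      stripDomain ε F G σ := by
    ext z
    constructor
    · rintro ⟨w, hw, rfl⟩
      exact ⟨(w.1, -w.2), ⟨mem_univ _, hneg hw.2⟩, rfl⟩
    · rintro ⟨w, hw, rfl⟩
      exact ⟨(w.1, -w.2), ⟨mem_univ _, hneg hw.2⟩, by simp [hPsi]⟩
  have hphi : EqOn (stripPhi ε (fun s => F (-s)) (fun s => G (-s)) (fun s => σ (-s)))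
      (stripPhi ε F G σ) (stripDomain ε F G σ) := by
    rintro _ ⟨w, hw, rfl⟩
    have h1 : PsiInv ε (fun s => F (-s)) (fun s => G (-s)) (fun s => σ (-s)) (Psi F G σ w) =
        (w.1, -w.2) := by
      have h2 : Psi F G σ w = Psi (fun s => F (-s)) (fun s => G (-s)) (fun s => σ (-s))
          (w.1, -w.2) := by simp [hPsi]
      rw [h2]
      exact hinj.leftInvOn_invFunOn ⟨mem_univ _, hneg hw.2⟩
    rw [hS.stripPhi_Psi hw.2, stripPhi, h1]
    simp [Psi]
  refine ⟨hS.eps_pos, hc hS.contDiffOn_F, hc hS.contDiffOn_G, hc hS.contDiffOn_σ, fun s hs => ?_,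
    hinj, ?_⟩
  · have := hS.strict _ (hneg hs)
    -- Every derivative changes sign, but the strictness inequality is quadratic in the derivatives
    -- and is preserved.
    rw [deriv_comp_neg, deriv_comp_neg, deriv_comp_neg]
    linarith
  · rw [hdom, hS.eq_graph]
    refine image_congr fun z hz => ?_
    rw [graphMap, graphMap, hphi hz]

/-- At a zero of `G'` strictness would read `F'² < 0`; the intermediate value theorem for the
continuous `G'` then excludes a change of sign. -/
theorem deriv_pos_or_neg (hS : IsStrictStrip ε F G σ S) :
    (∀ s ∈ stripJ ε, 0 < deriv G s) ∨ ∀ s ∈ stripJ ε, deriv G s < 0 := by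
  by_contra! h
  obtain ⟨⟨s, hs, hs'⟩, t, ht, ht'⟩ := h
  obtain ⟨r, hr, hr'⟩ := isPreconnected_Ioo.intermediate_value hs ht
    hS.contDiffOn_G.continuousOn_deriv_stripJ ⟨hs', ht'⟩
  have := hS.strict r hr
  rw [hr', mul_zero] at this
  exact absurd this (not_lt.2 (sq_nonneg _))

theorem exists_secondVariation_neg (hS : IsStrictStrip ε F G σ S) : ∃ ψ : H1 → ℝ, C20 S ψ ∧
      ContDiffAt ℝ 2 (perimeterVariation S (fieldX1 ψ)) 0 ∧ secondVariation S (fieldX1 ψ) < 0 := by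
  rcases hS.deriv_pos_or_neg with hG | hG
  · exact hS.exists_secondVariation_neg_of_pos hG
  · refine hS.reflect.exists_secondVariation_neg_of_pos fun s hs => ?_
    rw [deriv_comp_neg]
    have := hG (-s) ⟨by linarith [hs.2], by linarith [hs.1]⟩
    linarith

end Heisenberg.IsStrictStrip

theorem C20_zero (S : Set H1) : C20 S fun _ => 0 :=
  ⟨contDiffOn_const, ∅, empty_subset _, isCompact_empty, fun _ _ => rfl⟩

theorem theoremA (ε : ℝ) (F G σ : ℝ → ℝ) (S : Set H1) (hS : IsStrictStrip ε F G σ S) :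
    -- some direction `ψ X₁` has negative second variation
    (∃ ψ : H1 → ℝ, C20 S ψ ∧ ContDiffAt ℝ 2 (perimeterVariation S (fieldX1 ψ)) 0 ∧
      secondVariation S (fieldX1 ψ) < 0) ∧
    -- the strip is unstable
    ¬ IsStable S ∧
    -- the explicit test functions and the limit of their second variations
    ((∀ s ∈ stripJ ε, 0 < deriv G s) →
      ∀ (δ : ℝ) (χ ζ : ℝ → ℝ), 0 < δ → δ < 2 * ε → IsCutoff δ χ → IsMollifier ζ →
        (∀ᶠ k : ℕ in atTop, C20 S (testSurface ε χ ζ F G σ k) ∧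
          ContDiffAt ℝ 2 (perimeterVariation S (fieldX1 (testSurface ε χ ζ F G σ k))) 0) ∧
        Tendsto (fun k : ℕ => secondVariation S (fieldX1 (testSurface ε χ ζ F G σ k)))
          atTop (𝓝 ((Real.pi / 2 - 2 * Real.pi) * limitIntegral ε χ F G σ)) ∧
        0 < limitIntegral ε χ F G σ) := by
  refine ⟨hS.exists_secondVariation_neg, fun hstable => ?_, fun hG δ χ ζ hδ hδε hχ hζ => ?_⟩
  · obtain ⟨ψ, h1, -, h3⟩ := hS.exists_secondVariation_neg
    exact absurd h3 (not_lt.2 (hstable ψ _ _ h1 (C20_zero S) (C20_zero S)))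
  · exact ⟨(hS.secondVariation_testSurface hG hδ hδε hχ hζ).mono fun k hk =>
      ⟨hk.1, hk.2.1.contDiffAt⟩, hS.tendsto_secondVariation_testSurface hG hδ hδε hχ hζ,
      hS.limitIntegral_pos hG hδ hδε hχ⟩
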